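/- Let $0<q<1$, $0<a\le 1$, let $M\ge 2$ be an integer, and put $[x]_q=\frac{1-q^x}{1-q}$, $\delta=\frac{2\pi i}{\log q}$, $(z)_k=z(z+1)\cdots(z+k-1)$ (with $(z)_0=1$). For $s,t\in\mathbb{C}$ with $\mathrm{Re}(t)>0$ let $$g_q(s,t,a)=\sum_{n=0}^{\infty}\frac{q^{(n+a)t}}{[n+a]_q^{\,s}},$$ and for $0<x<1$, $\mathrm{Re}(\alpha)>0$ let $b_x(\alpha,\beta)=\int_0^x u^{\alpha-1}(1-u)^{\beta-1}\,du$; both converge absolutely. For $\mathrm{Re}(\alpha)>1-M$, $\alpha\notin\{0,-1,\dots,-(M-2)\}$, the function $b_x(\alpha,\beta)$ is continued analytically (holomorphically in $(\alpha,\beta)$) by $$b_x(\alpha,\beta)=\sum_{l=1}^{M-1}(-1)^{l-1}\frac{(1-\beta)_{l-1}}{(\alpha)_l}x^{\alpha+l-1}(1-x)^{\beta-l}+(-1)^{M-1}\frac{(1-\beta)_{M-1}}{(\alpha)_{M-1}}\,b_x(\alpha+M-1,\beta-M+1).$$ This is used with $x=q^a$. Put $$a_0(s,t;q)=-\tfrac12(\log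 q)^2(s-t)^2,\quad a_1(s,t;q)=\tfrac12(\log q)^2s(2s-2t+1),\quad a_2(s,t;q)=-\tfrac12(\log q)^2s(s+1),$$ and, for $\varepsilon=0,1,2$, $$C_\varepsilon(s,t,M;q)=\sum_{n\in\mathbb{Z}\setminus\{0\}}\frac{1}{(2\pi in)^2}\Biggl\{[a]_q^{-s}\sum_{k=1}^{M-1}\frac{(-1)^{k-1}(s+\varepsilon)_{k-1}}{(1-q^a)^k(t+\delta n)_k}q^{a(t+k-1)}$$ $$\qquad-\Bigl(\frac{1-q^a}{\log q}\Bigr)^{-1}[a]_q^{\,\varepsilon}\,\frac{(-1)^{M-1}(s+\varepsilon)_{M-1}}{(1-q)^{M-1}(t+\delta n)_{M-1}}\int_0^\infty e^{2\pi inx}q^{(x+a)(t+M-1)}[x+a]_q^{-s-\varepsilon+1-M}\,dx\Biggr\},$$ $$\widetilde C_\varepsilon(s,t,M;q)=\frac{2(1-q^a)^{1-\varepsilon}}{\log q}\,a_\varepsilon(s,t;q)\,C_\varepsilon(s,t,M;q).$$ Let $P=\{-j-\delta n: n\in\mathbb{Z},\ 0\le j\le M-2\}$. The integrals and series in $C_\varepsilon$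 converge absolutely for $\mathrm{Re}(s)>-M$, $\mathrm{Re}(t)>1-M$, $t\notin P$. If $\mathrm{Re}(s)>-M$ and $\mathrm{Re}(t)>0$, then $$g_q(s,t,a)=\frac12q^{at}[a]_q^{-s}-\frac1{12}q^{at}[a]_q^{-s}\Biggl(\Bigl(\frac{1-q^a}{\log q}\Bigr)^{-1}s+(t-s)\log q\Biggr)-\frac{(1-q)^s}{\log q}\,b_{q^a}(t,-s+1)+\sum_{\varepsilon=0}^{2}\widetilde C_\varepsilon(s,t,M;q).$$ Moreover the right-hand side, with $b_{q^a}(t,-s+1)$ continued as above, gives the analytic continuation of $g_q(s,t,a)$ to the region $\mathrm{Re}(s)>-M$, $\mathrm{Re}(t)>1-M$: it equals $g_q(s,t,a)$ for $\mathrm{Re}(t)>0$, it is holomorphic in $(s,t)$ for $t\notin P$, and it is meromorphic with at most a simple pole along each $t=t_0$, $t_0\in P$ (that is, on $\{\mathrm{Re}(s)>-M\}\times U$ for some open neighbourhood $U$ of $t_0$ it equals $H(s,t)/(t-t_0)$ for $t\neq t_0$ with $H$ holomorphic). -/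

import Mathlib

/-- The `n`-th term `q^{(n+a)t} / [n+a]_q^s` of the `q`-Hurwitz zeta series, where
`[x]_q = (1 - q^x) / (1 - q)`. -/
noncomputable def qHurwitzTerm (q : ℝ) (s t : ℂ) (a : ℝ) (n : ℕ) : ℂ :=
  (q : ℂ) ^ (((n : ℂ) + (a : ℂ)) * t) /
    (((1 - q ^ ((n : ℝ) + a)) / (1 - q) : ℝ) : ℂ) ^ s

/-- The series `g_q(s,t,a) = ∑_{n ≥ 0} q^{(n+a)t} / [n+a]_q^s`. -/
noncomputable def qHurwitz (q : ℝ) (s t : ℂ) (a : ℝ) : ℂ :=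
  ∑' n : ℕ, qHurwitzTerm q s t a n

/-- The integrand `u^{α-1} (1-u)^{β-1}` of the incomplete beta function. -/
noncomputable def incBetaIntegrand (α β : ℂ) (u : ℝ) : ℂ :=
  (u : ℂ) ^ (α - 1) * ((1 - u : ℝ) : ℂ) ^ (β - 1)

/-- The incomplete beta function `b_x(α,β) = ∫_0^x u^{α-1} (1-u)^{β-1} du`. -/
noncomputable def incBeta (x : ℝ) (α β : ℂ) : ℂ :=
  ∫ u in (0 : ℝ)..x, incBetaIntegrand α β u

/-- The rising factorial `(z)_k = z (z+1) ⋯ (z+k-1)`. -/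
noncomputable def risingFact (z : ℂ) (k : ℕ) : ℂ :=
  ∏ j ∈ Finset.range k, (z + (j : ℂ))

/-- The continuation of `b_x(α,β)` to `Re α > 1 - M` obtained by `M - 1` integrations by parts. -/
noncomputable def incBetaCont (M : ℕ) (x : ℝ) (α β : ℂ) : ℂ :=
  (∑ l ∈ Finset.Icc 1 (M - 1),
      (-1 : ℂ) ^ (l - 1) * risingFact (1 - β) (l - 1) / risingFact α l *
        (x : ℂ) ^ (α + (l : ℂ) - 1) * ((1 - x : ℝ) : ℂ) ^ (β - (l : ℂ))) +
    (-1 : ℂ) ^ (M - 1) * risingFact (1 - β) (M - 1) / risingFact α (M - 1) *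
      incBeta x (α + (M : ℂ) - 1) (β - (M : ℂ) + 1)

/-- `δ = 2πi / log q`. -/
noncomputable def qDelta (q : ℝ) : ℂ :=
  2 * (Real.pi : ℂ) * Complex.I / (Real.log q : ℂ)

/-- The coefficients `a_ε(s,t;q)`, `ε = 0, 1, 2`. -/
noncomputable def qCoeff (q : ℝ) (s t : ℂ) (ε : Fin 3) : ℂ :=
  match ε with
  | 0 => -(1 / 2) * (Real.log q : ℂ) ^ 2 * (s - t) ^ 2
  | 1 => (1 / 2) * (Real.log q : ℂ) ^ 2 * s * (2 * s - 2 * t + 1)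
  | 2 => -(1 / 2) * (Real.log q : ℂ) ^ 2 * s * (s + 1)

/-- The integrand `e^{2πinx} q^{(x+a)(t+M-1)} ((1 - q^{x+a}) / (1 - q))^{-s-ε+1-M}`. -/
noncomputable def qFourierIntegrand (q a : ℝ) (M : ℕ) (s t : ℂ) (ε : Fin 3) (n : ℤ) (x : ℝ) : ℂ :=
  Complex.exp (2 * (Real.pi : ℂ) * Complex.I * (n : ℂ) * (x : ℂ)) *
    (q : ℂ) ^ (((x : ℂ) + (a : ℂ)) * (t + (M : ℂ) - 1)) *
    (((1 - q ^ (x + a)) / (1 - q) : ℝ) : ℂ) ^ (-s - ((ε : ℕ) : ℂ) + 1 - (M : ℂ))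

/-- The `n`-th term of the series `C_ε(s,t,M;q)`. -/
noncomputable def qFourierTerm (q a : ℝ) (M : ℕ) (s t : ℂ) (ε : Fin 3) (n : ℤ) : ℂ :=
  1 / (2 * (Real.pi : ℂ) * Complex.I * (n : ℂ)) ^ 2 *
    ((((1 - q ^ a) / (1 - q) : ℝ) : ℂ) ^ (-s) *
        (∑ k ∈ Finset.Icc 1 (M - 1),
          (-1 : ℂ) ^ (k - 1) * risingFact (s + ((ε : ℕ) : ℂ)) (k - 1) /
              (((1 - q ^ a : ℝ) : ℂ) ^ k * risingFact (t + qDelta q * (n : ℂ)) k) *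
            (q : ℂ) ^ ((a : ℂ) * (t + (k : ℂ) - 1))) -
      (((1 - q ^ a) / Real.log q : ℝ) : ℂ)⁻¹ * (((1 - q ^ a) / (1 - q) : ℝ) : ℂ) ^ (ε : ℕ) *
        ((-1 : ℂ) ^ (M - 1) * risingFact (s + ((ε : ℕ) : ℂ)) (M - 1) /
          (((1 - q : ℝ) : ℂ) ^ (M - 1) * risingFact (t + qDelta q * (n : ℂ)) (M - 1))) *
        ∫ x in Set.Ioi (0 : ℝ), qFourierIntegrand q a M s t ε n x)

/-- `C_ε(s,t,M;q)`, a sum over the nonzero integers. -/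
noncomputable def qFourierC (q a : ℝ) (M : ℕ) (s t : ℂ) (ε : Fin 3) : ℂ :=
  ∑' n : {n : ℤ // n ≠ 0}, qFourierTerm q a M s t ε n

/-- `C̃_ε(s,t,M;q) = (2 (1 - q^a)^{1-ε} / log q) a_ε(s,t;q) C_ε(s,t,M;q)`. -/
noncomputable def qFourierCTilde (q a : ℝ) (M : ℕ) (s t : ℂ) (ε : Fin 3) : ℂ :=
  2 * ((1 - q ^ a : ℝ) : ℂ) ^ (1 - ((ε : ℕ) : ℤ)) / (Real.log q : ℂ) *
    qCoeff q s t ε * qFourierC q a M s t ε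

/-- The explicit boundary terms of the summation formula. -/
noncomputable def qBoundary (q a : ℝ) (s t : ℂ) : ℂ :=
  (1 / 2) * (q : ℂ) ^ ((a : ℂ) * t) * (((1 - q ^ a) / (1 - q) : ℝ) : ℂ) ^ (-s) -
    (1 / 12) * (q : ℂ) ^ ((a : ℂ) * t) * (((1 - q ^ a) / (1 - q) : ℝ) : ℂ) ^ (-s) *
      ((((1 - q ^ a) / Real.log q : ℝ) : ℂ)⁻¹ * s + (t - s) * (Real.log q : ℂ))

/-- The right-hand side of the formula for `g_q(s,t,a)`, with the incomplete beta function
replaced by its continuation to `Re t > 1 - M`. -/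
noncomputable def qHurwitzCont (q a : ℝ) (M : ℕ) (s t : ℂ) : ℂ :=
  qBoundary q a s t -
    ((1 - q : ℝ) : ℂ) ^ s / (Real.log q : ℂ) * incBetaCont M (q ^ a) t (-s + 1) +
    ∑ ε : Fin 3, qFourierCTilde q a M s t ε

/-- The polar set `{-j - δn : n ∈ ℤ, 0 ≤ j ≤ M - 2}`. -/
def qPoles (q : ℝ) (M : ℕ) : Set ℂ :=
  {t | ∃ (n : ℤ) (j : ℕ), j + 2 ≤ M ∧ t = -(j : ℂ) - qDelta q * (n : ℂ)}

/-! Apply Euler–Maclaurin of order two to `f(x) = q^{(x+a)t} [x+a]_q^{-s}` and expand the periodic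
Bernoulli function of the remainder into its Fourier series (`tsum_eq_integral_add_tsum_fourier`).
Since `q^{x+a} = 1 - (1-q)[x+a]_q`, differentiating `f` only produces the same kernel with `s`,
`s+1`, `s+2`; the coefficients in `f''` are, up to normalisation, the `a_ε`.

The substitution `u = q^{x+a}` turns `e^{2πinx}` into `u^{δn}` times a phase, so every integral
becomes an incomplete beta function `b_{q^a}(t+δn, 1-s-ε)` (`integral_qKernel`). The bracket in
`C_ε` is this function after `M-1` integrations by parts (`qFourierTerm_eq`). Hence the right-hand
side is an entire boundary term plus multiples of series `∑ c_n b(t+δn, β)` with `c` absolutely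
summable (`qHurwitzCont_eq`), and the continuation question concerns these series alone.

As `δ` is purely imaginary and `|u^{α-1}|` depends only on `Re α`, the beta integrals are bounded
uniformly in `n`; the denominators `(t+δn)_k` are uniformly bounded below because the points
`t+δn+j` do not accumulate. The series therefore converge normally and are holomorphic off the
poles. A pole `t₀` annihilates exactly one factor `t+δn+j`, so splitting off a single term shows
that it is at most simple (`exists_isOpen_incBetaContSum_eq_div`). -/

open Complex MeasureTheory Set Filter Topology

/-! ### Holomorphy of dominated series and integrals in several variables -/

section SeveralVariables

variable {E : Type*} [NormedAddCommGroup E] [NormedSpace ℂ E]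

/-- Cauchy's estimate for the Fréchet derivative. -/
theorem norm_fderiv_le_of_norm_le_on_ball {f : E → ℂ} {x₀ x : E} {r C : ℝ} (hr : 0 < r)
    (hd : DifferentiableOn ℂ f (Metric.ball x₀ r)) (hC : ∀ y ∈ Metric.ball x₀ r, ‖f y‖ ≤ C)
    (hx : x ∈ Metric.ball x₀ (r / 2)) : ‖fderiv ℂ f x‖ ≤ 4 * C / r := by
  have hsub : Metric.ball x (r / 2) ⊆ Metric.ball x₀ r := by
    refine Metric.ball_subset_ball' ?_
    rw [Metric.mem_ball] at hx
    linarith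
  -- Oscillation at most `2C` on a ball of radius `r/2`: this is where `4C/r` comes from.
  have hmaps : MapsTo f (Metric.ball x (r / 2)) (Metric.closedBall (f x) (2 * C)) := by
    intro y hy
    rw [Metric.mem_closedBall, dist_eq_norm]
    have h1 := hC y (hsub hy)
    have h2 := hC x (hsub (Metric.mem_ball_self (by positivity)))
    linarith [norm_sub_le (f y) (f x)]
  have := Complex.norm_fderiv_le_div_of_mapsTo_ball (hd.mono hsub) hmaps (by positivity)
  convert this using 1
  field_simp
  ring

/-- By Cauchy's estimate, a summable bound for the terms on a ball gives one for their derivatives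
on the half ball, so termwise differentiation is allowed without estimating any derivative by hand.
-/
theorem differentiableAt_tsum_of_norm_le_on_ball {ι : Type*} {f : ι → E → ℂ} {u : ι → ℝ} {x₀ : E}
    {r : ℝ} (hr : 0 < r) (hu : Summable u)
    (hd : ∀ i, DifferentiableOn ℂ (f i) (Metric.ball x₀ r))
    (hb : ∀ i, ∀ y ∈ Metric.ball x₀ r, ‖f i y‖ ≤ u i) :
    DifferentiableAt ℂ (fun y => ∑' i, f i y) x₀ := by
  have hr2 : 0 < r / 2 := by positivity
  -- The real structure serves only to make the ball convex, hence preconnected.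
  let _ : NormedSpace ℝ E := NormedSpace.restrictScalars ℝ ℂ E
  refine (hasFDerivAt_tsum_of_isPreconnected (u := fun i => 4 * u i / r)
    (f' := fun i x => fderiv ℂ (f i) x) ((hu.mul_left 4).div_const r)
    Metric.isOpen_ball (convex_ball x₀ (r / 2)).isPreconnected ?_ ?_
    (Metric.mem_ball_self hr2) ?_ (Metric.mem_ball_self hr2)).differentiableAt
  · intro i x hx
    have hx' := Metric.ball_subset_ball (by linarith : r / 2 ≤ r) hx
    exact ((hd i).differentiableAt (Metric.isOpen_ball.mem_nhds hx')).hasFDerivAt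
  · intro i x hx
    exact norm_fderiv_le_of_norm_le_on_ball hr (hd i) (hb i) hx
  · exact hu.of_norm_bounded fun i => hb i x₀ (Metric.mem_ball_self hr)

/-- The same use of Cauchy's estimate, now feeding dominated differentiation under the integral
sign. -/
theorem differentiableAt_integral_of_norm_le_on_ball {α : Type*} [MeasurableSpace α]
    {μ : Measure α} {F : E → α → ℂ} {bound : α → ℝ} {x₀ : E} {r : ℝ} (hr : 0 < r)
    (hF : ∀ y ∈ Metric.ball x₀ r, AEStronglyMeasurable (F y) μ)
    (hF' : AEStronglyMeasurable (fun a => fderiv ℂ (F · a) x₀) μ)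
    (hd : ∀ᵐ a ∂μ, DifferentiableOn ℂ (F · a) (Metric.ball x₀ r))
    (hb : ∀ᵐ a ∂μ, ∀ y ∈ Metric.ball x₀ r, ‖F y a‖ ≤ bound a) (hbound : Integrable bound μ) :
    DifferentiableAt ℂ (fun y => ∫ a, F y a ∂μ) x₀ := by
  have hr2 : 0 < r / 2 := by positivity
  have hx₀ := Metric.mem_ball_self (x := x₀) hr
  refine (hasFDerivAt_integral_of_dominated_of_fderiv_le (𝕜 := ℂ)
    (F' := fun x a => fderiv ℂ (F · a) x) (bound := fun a => 4 * bound a / r)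
    (Metric.ball_mem_nhds x₀ hr2) ?_ ?_ hF' ?_ ?_ ?_).differentiableAt
  · filter_upwards [Metric.ball_mem_nhds x₀ hr] with y hy using hF y hy
  · exact hbound.mono' (hF x₀ hx₀) (hb.mono fun a ha => ha x₀ hx₀)
  · filter_upwards [hd, hb] with a ha hba x hx
    exact norm_fderiv_le_of_norm_le_on_ball hr ha hba hx
  · exact (hbound.const_mul 4).div_const r
  · filter_upwards [hd] with a ha x hx
    have hx' := Metric.ball_subset_ball (by linarith : r / 2 ≤ r) hx
    exact (ha.differentiableAt (Metric.isOpen_ball.mem_nhds hx')).hasFDerivAt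

end SeveralVariables

/-! ### Rising factorials -/

theorem risingFact_succ (z : ℂ) (k : ℕ) : risingFact z (k + 1) = risingFact z k * (z + k) := by
  simp [risingFact, Finset.prod_range_succ]

theorem risingFact_ne_zero {z : ℂ} {k : ℕ} (h : ∀ j < k, z + (j : ℂ) ≠ 0) : risingFact z k ≠ 0 :=
  Finset.prod_ne_zero_iff.2 fun j hj => h j (Finset.mem_range.1 hj)

theorem differentiable_risingFact (k : ℕ) : Differentiable ℂ fun z => risingFact z k := by
  unfold risingFact
  fun_prop

/-! ### The incomplete beta function and integration by parts -/

section IncBeta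

variable {x : ℝ}

theorem intervalIntegrable_incBetaIntegrand (hx0 : 0 < x) (hx1 : x < 1) {α : ℂ} (hα : 0 < α.re)
    (β : ℂ) : IntervalIntegrable (incBetaIntegrand α β) volume 0 x := by
  apply IntervalIntegrable.mul_continuousOn
  · refine intervalIntegral.intervalIntegrable_cpow' ?_
    simpa using hα
  · refine continuousOn_of_forall_continuousAt fun u hu => ?_
    rw [uIcc_of_le hx0.le] at hu
    exact ContinuousAt.cpow (by fun_prop) continuousAt_const
      (ofReal_mem_slitPlane.2 (by linarith [hu.2]))

/-- Only real parts enter, so bounds for `α` also hold for all `α + δn`. -/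
theorem norm_incBetaIntegrand {u : ℝ} (hu0 : 0 < u) (hu1 : u < 1) (α β : ℂ) :
    ‖incBetaIntegrand α β u‖ = u ^ (α.re - 1) * (1 - u) ^ (β.re - 1) := by
  rw [incBetaIntegrand, norm_mul, norm_cpow_eq_rpow_re_of_pos hu0,
    norm_cpow_eq_rpow_re_of_pos (sub_pos.2 hu1)]
  simp

theorem norm_incBetaIntegrand_le {u : ℝ} (hu0 : 0 < u) (hu1 : u < 1) {α β : ℂ} {c d : ℝ}
    (hc : c ≤ α.re) (hd : d ≤ β.re) :
    ‖incBetaIntegrand α β u‖ ≤ u ^ (c - 1) * (1 - u) ^ (d - 1) := by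
  rw [norm_incBetaIntegrand hu0 hu1]
  have : 0 < 1 - u := by linarith
  gcongr ?_ * ?_
  · exact Real.rpow_le_rpow_of_exponent_ge hu0 hu1.le (by linarith)
  · exact Real.rpow_le_rpow_of_exponent_ge this (by linarith) (by linarith)

theorem integrableOn_rpow_mul_one_sub_rpow (hx0 : 0 < x) (hx1 : x < 1) {c : ℝ} (hc : 0 < c)
    (d : ℝ) : IntegrableOn (fun u : ℝ => u ^ (c - 1) * (1 - u) ^ (d - 1)) (Ioc 0 x) := by
  have h : IntegrableOn (fun u => ‖incBetaIntegrand c d u‖) (Ioc 0 x) :=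
    ((intervalIntegrable_iff_integrableOn_Ioc_of_le hx0.le).1
    (intervalIntegrable_incBetaIntegrand hx0 hx1 (α := c) (by simpa using hc) d)).norm
  refine h.congr_fun (fun u hu => ?_) measurableSet_Ioc
  simpa using norm_incBetaIntegrand hu.1 (hu.2.trans_lt hx1) c d

theorem norm_incBeta_le (hx0 : 0 < x) (hx1 : x < 1) {α β : ℂ} {c d : ℝ} (hc0 : 0 < c)
    (hc : c ≤ α.re) (hd : d ≤ β.re) :
    ‖incBeta x α β‖ ≤ ∫ u in Ioc 0 x, u ^ (c - 1) * (1 - u) ^ (d - 1) := by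
  rw [incBeta, intervalIntegral.integral_of_le hx0.le]
  refine norm_integral_le_of_norm_le (integrableOn_rpow_mul_one_sub_rpow hx0 hx1 hc0 d) ?_
  refine (ae_restrict_iff' measurableSet_Ioc).2 (.of_forall fun u hu => ?_)
  exact norm_incBetaIntegrand_le hu.1 (hu.2.trans_lt hx1) hc hd

/-- The explicit derivative is needed to see that it is measurable in `u`. -/
theorem hasFDerivAt_incBetaIntegrand {u : ℝ} (hu0 : 0 < u) (hu1 : u < 1) (p : ℂ × ℂ) :
    HasFDerivAt (fun p : ℂ × ℂ => incBetaIntegrand p.1 p.2 u)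
      (incBetaIntegrand p.1 p.2 u • ((Real.log u : ℂ) • ContinuousLinearMap.fst ℂ ℂ ℂ +
        (Real.log (1 - u) : ℂ) • ContinuousLinearMap.snd ℂ ℂ ℂ)) p := by
  have h0 : (u : ℂ) ≠ 0 := ofReal_ne_zero.2 hu0.ne'
  have h1 : ((1 - u : ℝ) : ℂ) ≠ 0 := ofReal_ne_zero.2 (sub_pos.2 hu1).ne'
  have e : (fun p : ℂ × ℂ => incBetaIntegrand p.1 p.2 u) = fun p : ℂ × ℂ =>
      exp ((Real.log u : ℂ) * (p.1 - 1) + (Real.log (1 - u) : ℂ) * (p.2 - 1)) := by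
    funext p
    rw [incBetaIntegrand, cpow_def_of_ne_zero h0, cpow_def_of_ne_zero h1, ← exp_add,
      ofReal_log hu0.le, ofReal_log (sub_pos.2 hu1).le]
  have e' := congrFun e p
  rw [e', e]
  refine HasFDerivAt.cexp ?_
  exact ((hasFDerivAt_fst.sub_const 1).const_mul _).add ((hasFDerivAt_snd.sub_const 1).const_mul _)

theorem continuousOn_incBetaIntegrand (hx1 : x < 1) (α β : ℂ) :
    ContinuousOn (incBetaIntegrand α β) (Ioc 0 x) := by
  refine continuousOn_of_forall_continuousAt fun u hu => ?_
  refine ContinuousAt.mul ?_ ?_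
  · exact ContinuousAt.cpow (by fun_prop) continuousAt_const (ofReal_mem_slitPlane.2 hu.1)
  · exact ContinuousAt.cpow (by fun_prop) continuousAt_const (ofReal_mem_slitPlane.2 (by linarith [hu.2]))

theorem differentiableAt_incBeta (hx0 : 0 < x) (hx1 : x < 1) {p : ℂ × ℂ} (hp : 0 < p.1.re) :
    DifferentiableAt ℂ (fun p : ℂ × ℂ => incBeta x p.1 p.2) p := by
  simp only [incBeta, intervalIntegral.integral_of_le hx0.le]
  -- Radius `Re α / 2` keeps the exponent at `u = 0` integrable throughout the ball; near `u = x <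
  -- 1` there is no singularity.
  have hre : ∀ y ∈ Metric.ball p (p.1.re / 2),
      p.1.re / 2 ≤ y.1.re ∧ p.2.re - p.1.re / 2 ≤ y.2.re := by
    intro y hy
    rw [Metric.mem_ball, dist_eq_norm] at hy
    have h1 := (abs_re_le_norm _).trans (norm_fst_le (y - p))
    have h2 := (abs_re_le_norm _).trans (norm_snd_le (y - p))
    simp only [Prod.fst_sub, Prod.snd_sub, sub_re] at h1 h2
    constructor <;> linarith [abs_le.1 h1, abs_le.1 h2]
  refine differentiableAt_integral_of_norm_le_on_ball (r := p.1.re / 2) (by positivity)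
    (F := fun (p : ℂ × ℂ) u => incBetaIntegrand p.1 p.2 u)
    (bound := fun u => u ^ (p.1.re / 2 - 1) * (1 - u) ^ (p.2.re - p.1.re / 2 - 1)) ?_ ?_ ?_ ?_ ?_
  · exact fun y _ => (continuousOn_incBetaIntegrand hx1 _ _).aestronglyMeasurable measurableSet_Ioc
  · have hc : ContinuousOn (fun u : ℝ => incBetaIntegrand p.1 p.2 u •
        ((Real.log u : ℂ) • ContinuousLinearMap.fst ℂ ℂ ℂ +
        (Real.log (1 - u) : ℂ) • ContinuousLinearMap.snd ℂ ℂ ℂ)) (Ioc 0 x) := by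
      refine (continuousOn_incBetaIntegrand hx1 _ _).smul (ContinuousOn.add ?_ ?_)
      · refine ContinuousOn.smul (continuous_ofReal.comp_continuousOn ?_) continuousOn_const
        exact Real.continuousOn_log.mono fun u hu => hu.1.ne'
      · refine ContinuousOn.smul (continuous_ofReal.comp_continuousOn ?_) continuousOn_const
        exact ContinuousOn.log (by fun_prop) fun u hu => by linarith [hu.2]
    refine (hc.congr fun u hu => ?_).aestronglyMeasurable measurableSet_Ioc
    exact (hasFDerivAt_incBetaIntegrand hu.1 (hu.2.trans_lt hx1) p).fderiv
  · refine (ae_restrict_iff' measurableSet_Ioc).2 (.of_forall fun u hu y _ => ?_)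
    exact (hasFDerivAt_incBetaIntegrand hu.1 (hu.2.trans_lt hx1) y).differentiableAt
      |>.differentiableWithinAt
  · refine (ae_restrict_iff' measurableSet_Ioc).2 (.of_forall fun u hu y hy => ?_)
    exact norm_incBetaIntegrand_le hu.1 (hu.2.trans_lt hx1) (hre y hy).1 (hre y hy).2
  · exact integrableOn_rpow_mul_one_sub_rpow hx0 hx1 (by positivity) _

/-- Integrate the derivative of `u^α (1-u)^{β-1}` over `[0,x]`; the value at `0` vanishes because
`Re α > 0`. -/
theorem incBeta_eq_add (hx0 : 0 < x) (hx1 : x < 1) {α : ℂ} (hα : 0 < α.re) (β : ℂ) :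
    incBeta x α β = (x : ℂ) ^ α * ((1 - x : ℝ) : ℂ) ^ (β - 1) / α -
      (1 - β) / α * incBeta x (α + 1) (β - 1) := by
  have hα0 : α ≠ 0 := fun h => by simp [h] at hα
  have hi1 := intervalIntegrable_incBetaIntegrand hx0 hx1 hα β
  have hi2 := intervalIntegrable_incBetaIntegrand hx0 hx1 (α := α + 1) (by simp; linarith) (β - 1)
  have key : ∫ u in (0 : ℝ)..x, (α * incBetaIntegrand α β u +
      (1 - β) * incBetaIntegrand (α + 1) (β - 1) u) =
      (x : ℂ) ^ α * ((1 - x : ℝ) : ℂ) ^ (β - 1) -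
        ((0 : ℝ) : ℂ) ^ α * ((1 - 0 : ℝ) : ℂ) ^ (β - 1) := by
    refine intervalIntegral.integral_eq_sub_of_hasDerivAt_of_le hx0.le
      (f := fun u : ℝ => (u : ℂ) ^ α * ((1 - u : ℝ) : ℂ) ^ (β - 1)) ?_ ?_
      ((hi1.const_mul α).add (hi2.const_mul (1 - β)))
    · refine ContinuousOn.mul ?_ ?_
      · exact (continuous_ofReal_cpow_const hα).continuousOn
      · refine continuousOn_of_forall_continuousAt fun u hu => ?_
        exact ContinuousAt.cpow (by fun_prop) continuousAt_const (ofReal_mem_slitPlane.2 (by linarith [hu.2]))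
    · intro u hu
      have h1 : HasDerivAt (fun u : ℝ => (u : ℂ) ^ α) (α * (u : ℂ) ^ (α - 1)) u := by
        have := (hasDerivAt_id (u : ℂ)).cpow_const (c := α) (ofReal_mem_slitPlane.2 hu.1)
        simpa using this.comp_ofReal
      have h2 : HasDerivAt (fun u : ℝ => ((1 - u : ℝ) : ℂ) ^ (β - 1))
          ((β - 1) * ((1 - u : ℝ) : ℂ) ^ (β - 1 - 1) * (-1)) u := by
        have hs : (1 - (u : ℂ)) ∈ slitPlane := by
          have := ofReal_mem_slitPlane.2 (sub_pos.2 (hu.2.trans hx1))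
          simpa using this
        have := ((hasDerivAt_id (u : ℂ)).const_sub 1).cpow_const (c := β - 1) hs
        simpa using this.comp_ofReal
      refine (h1.mul h2).congr_deriv ?_
      simp only [incBetaIntegrand, add_sub_cancel_right]
      ring
  rw [intervalIntegral.integral_add (hi1.const_mul α) (hi2.const_mul (1 - β)),
    intervalIntegral.integral_const_mul, intervalIntegral.integral_const_mul, ofReal_zero,
    zero_cpow hα0, zero_mul, sub_zero] at key
  change α * incBeta x α β + (1 - β) * incBeta x (α + 1) (β - 1) = _ at key
  field_simp
  linear_combination key

/-- Induction on `M`: one integration by parts of the remaining integral yields the new top summand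
and the next remainder. -/
theorem incBetaCont_eq_incBeta (hx0 : 0 < x) (hx1 : x < 1) {M : ℕ} (hM : 1 ≤ M) {α : ℂ}
    (hα : 0 < α.re) (β : ℂ) : incBetaCont M x α β = incBeta x α β := by
  obtain ⟨m, rfl⟩ : ∃ m, M = m + 1 := ⟨M - 1, by omega⟩
  clear hM
  induction m with
  | zero => simp [incBetaCont, risingFact]
  | succ m ih =>
    rw [← ih, incBetaCont, incBetaCont]
    simp only [Nat.add_sub_cancel]
    rw [Finset.sum_Icc_succ_top (by omega), add_assoc]
    congr 1
    have hre : 0 < (α + m).re := by simp; positivity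
    have h0 : ∀ j : ℕ, α + j ≠ 0 := fun j h => by
      have : (α + j).re = 0 := by rw [h]; simp
      simp at this
      linarith [(Nat.cast_nonneg j : (0 : ℝ) ≤ j)]
    have hr : risingFact α m ≠ 0 := risingFact_ne_zero fun j _ => h0 j
    have e := incBeta_eq_add hx0 hx1 hre (β - m)
    simp only [Nat.cast_add, Nat.cast_one, Nat.add_sub_cancel]
    rw [show α + ((m : ℂ) + 1) - 1 = α + m by ring, show β - ((m : ℂ) + 1) + 1 = β - m by ring,
      show α + ((m : ℂ) + 1 + 1) - 1 = α + m + 1 by ring,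
      show β - ((m : ℂ) + 1 + 1) + 1 = β - m - 1 by ring, e, risingFact_succ, risingFact_succ]
    have h0m := h0 m
    rw [show β - ((m : ℂ) + 1) = β - m - 1 by ring]
    field_simp
    ring

end IncBeta

/-! ### Numerator, denominator and uniform bounds of the continued beta function -/

theorem risingFact_eq_mul (z : ℂ) {k m : ℕ} (h : k ≤ m) :
    risingFact z m = risingFact z k * risingFact (z + k) (m - k) := by
  obtain ⟨l, rfl⟩ := Nat.exists_eq_add_of_le h
  simp [risingFact, Finset.prod_range_add, add_assoc]

theorem norm_risingFact_le {z : ℂ} {K : ℝ} (h : ‖z‖ ≤ K) (k : ℕ) :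
    ‖risingFact z k‖ ≤ ∏ j ∈ Finset.range k, (K + j) := by
  rw [risingFact, norm_prod]
  refine Finset.prod_le_prod (fun _ _ => norm_nonneg _) fun j _ => ?_
  refine (norm_add_le _ _).trans ?_
  simpa using h

theorem pow_le_norm_risingFact {z : ℂ} {η : ℝ} (hη : 0 < η) {k : ℕ}
    (h : ∀ j < k, η ≤ ‖z + (j : ℂ)‖) : η ^ k ≤ ‖risingFact z k‖ := by
  rw [risingFact, norm_prod]
  calc η ^ k = ∏ j ∈ Finset.range k, η := by simp
    _ ≤ _ := Finset.prod_le_prod (fun _ _ => hη.le) fun j hj => h j (Finset.mem_range.1 hj)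

theorem DifferentiableAt.div_of_ne_zero {E : Type*} [NormedAddCommGroup E] [NormedSpace ℂ E]
    {f g : E → ℂ} {p : E} (hf : DifferentiableAt ℂ f p) (hg : DifferentiableAt ℂ g p)
    (h0 : g p ≠ 0) : DifferentiableAt ℂ (fun p => f p / g p) p := by
  simp only [div_eq_mul_inv]
  exact hf.fun_mul (hg.fun_inv h0)

/-- The product of `(α)_{M-1}` and the continued incomplete beta function. -/
noncomputable def incBetaNum (M : ℕ) (x : ℝ) (p : ℂ × ℂ) : ℂ :=
  (∑ l ∈ Finset.Icc 1 (M - 1),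
      (-1 : ℂ) ^ (l - 1) * risingFact (1 - p.2) (l - 1) * risingFact (p.1 + l) (M - 1 - l) *
        (x : ℂ) ^ (p.1 + (l : ℂ) - 1) * ((1 - x : ℝ) : ℂ) ^ (p.2 - (l : ℂ))) +
    (-1 : ℂ) ^ (M - 1) * risingFact (1 - p.2) (M - 1) *
      incBeta x (p.1 + (M : ℂ) - 1) (p.2 - (M : ℂ) + 1)

section

variable {x : ℝ} {M : ℕ}

/-- All denominators divide `(α)_{M-1}`, so the poles are isolated in this one factor and the
numerator stays holomorphic on all of `Re α > 1 - M`. -/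
theorem incBetaCont_eq_div {α β : ℂ} (h : risingFact α (M - 1) ≠ 0) :
    incBetaCont M x α β = incBetaNum M x (α, β) / risingFact α (M - 1) := by
  rw [incBetaCont, incBetaNum, add_div, Finset.sum_div]
  congr 1
  · refine Finset.sum_congr rfl fun l hl => ?_
    have e := risingFact_eq_mul α (Finset.mem_Icc.1 hl).2
    rw [e] at h ⊢
    have h1 := left_ne_zero_of_mul h
    have h2 := right_ne_zero_of_mul h
    simp only
    field_simp
  · ring

theorem differentiableAt_incBetaNum (hx0 : 0 < x) (hx1 : x < 1) {p : ℂ × ℂ}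
    (hp : 1 - (M : ℝ) < p.1.re) : DifferentiableAt ℂ (incBetaNum M x) p := by
  have hx : (x : ℂ) ≠ 0 := ofReal_ne_zero.2 hx0.ne'
  have hx' : ((1 - x : ℝ) : ℂ) ≠ 0 := ofReal_ne_zero.2 (sub_pos.2 hx1).ne'
  have hr : ∀ (k : ℕ) (f : ℂ × ℂ → ℂ), DifferentiableAt ℂ f p →
      DifferentiableAt ℂ (fun p => risingFact (f p) k) p :=
    fun k f hf => (differentiable_risingFact k).differentiableAt.comp p hf
  have hb : DifferentiableAt ℂ (fun p : ℂ × ℂ =>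
      incBeta x (p.1 + (M : ℂ) - 1) (p.2 - (M : ℂ) + 1)) p := by
    refine DifferentiableAt.comp (g := fun p : ℂ × ℂ => incBeta x p.1 p.2)
      (f := fun p : ℂ × ℂ => (p.1 + (M : ℂ) - 1, p.2 - (M : ℂ) + 1)) p
      (differentiableAt_incBeta hx0 hx1 ?_) (by fun_prop)
    simp
    linarith
  unfold incBetaNum
  refine DifferentiableAt.add (DifferentiableAt.fun_sum fun l _ => ?_) ?_
  · refine DifferentiableAt.mul (DifferentiableAt.mul (DifferentiableAt.mul
      (DifferentiableAt.mul (by fun_prop) (hr _ _ (by fun_prop))) (hr _ _ (by fun_prop))) ?_) ?_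
    · exact DifferentiableAt.const_cpow (by fun_prop) (Or.inl hx)
    · exact DifferentiableAt.const_cpow (by fun_prop) (Or.inl hx')
  · exact ((hr _ _ (by fun_prop)).const_mul _).mul hb

theorem differentiableAt_incBetaCont (hx0 : 0 < x) (hx1 : x < 1) {p : ℂ × ℂ}
    (hp : 1 - (M : ℝ) < p.1.re) (h : ∀ j < M - 1, p.1 + (j : ℂ) ≠ 0) :
    DifferentiableAt ℂ (fun p : ℂ × ℂ => incBetaCont M x p.1 p.2) p := by
  have hr : DifferentiableAt ℂ (fun p : ℂ × ℂ => risingFact p.1 (M - 1)) p :=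
    (differentiable_risingFact _).differentiableAt.comp p differentiableAt_fst
  have h0 := risingFact_ne_zero h
  refine ((differentiableAt_incBetaNum hx0 hx1 hp).div_of_ne_zero hr h0).congr_of_eventuallyEq ?_
  filter_upwards [hr.continuousAt.eventually_ne h0] with y hy using incBetaCont_eq_div hy

/-- A bound for the continued incomplete beta function, uniform in the imaginary part of the first
argument. -/
theorem exists_norm_incBetaCont_le (hx0 : 0 < x) (hx1 : x < 1) {c η : ℝ} (d K : ℝ)
    (hc : 1 - (M : ℝ) < c) (hη : 0 < η) :
    ∃ C : ℝ, ∀ α β : ℂ, c ≤ α.re → d ≤ β.re → ‖1 - β‖ ≤ K →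
      (∀ j < M - 1, η ≤ ‖α + (j : ℂ)‖) → ‖incBetaCont M x α β‖ ≤ C := by
  -- Termwise bound: `K` controls the numerators, `η` the factors of the denominators, and the
  -- powers of `x` and `1-x`, both in `(0,1)`, decrease in the exponent.
  refine ⟨(∑ l ∈ Finset.Icc 1 (M - 1), (∏ j ∈ Finset.range (l - 1), (K + j)) / η ^ l *
      x ^ (c + l - 1) * (1 - x) ^ (d - l)) + (∏ j ∈ Finset.range (M - 1), (K + j)) / η ^ (M - 1) *
      ∫ u in Ioc 0 x, u ^ (c + M - 1 - 1) * (1 - u) ^ (d - M + 1 - 1), fun α β hα hβ hK h => ?_⟩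
  have hx1' : 0 < 1 - x := sub_pos.2 hx1
  have hK0 : 0 ≤ K := (norm_nonneg _).trans hK
  rw [incBetaCont]
  refine (norm_add_le _ _).trans (add_le_add ((norm_sum_le _ _).trans
    (Finset.sum_le_sum fun l hl => ?_)) ?_)
  · rw [norm_mul, norm_mul, norm_div, norm_mul, norm_pow, norm_neg, norm_one, one_pow, one_mul,
      norm_cpow_eq_rpow_re_of_pos hx0, norm_cpow_eq_rpow_re_of_pos hx1']
    have hl' := (Finset.mem_Icc.1 hl).2
    gcongr ?_ / ?_ * ?_ * ?_
    · exact norm_risingFact_le hK _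
    · exact pow_le_norm_risingFact hη fun j hj => h j (by omega)
    · exact Real.rpow_le_rpow_of_exponent_ge hx0 hx1.le (by simp; linarith)
    · exact Real.rpow_le_rpow_of_exponent_ge hx1' (by linarith) (by simp; linarith)
  · rw [norm_mul, norm_div, norm_mul, norm_pow, norm_neg, norm_one, one_pow, one_mul]
    gcongr ?_ / ?_ * ?_
    · exact norm_risingFact_le hK _
    · exact pow_le_norm_risingFact hη h
    · exact norm_incBeta_le hx0 hx1 (by linarith) (by simp; linarith) (by simp; linarith)

end

/-! ### The points `t + δn + j` -/

theorem qDelta_re (q : ℝ) : (qDelta q).re = 0 := by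
  have : qDelta q = ((2 * Real.pi / Real.log q : ℝ) : ℂ) * I := by
    simp only [qDelta]
    push_cast
    ring
  rw [this]
  simp

theorem qDelta_mul_intCast_re (q : ℝ) (n : ℤ) : (qDelta q * (n : ℂ)).re = 0 := by
  simp [qDelta_re]

section

variable {q : ℝ}

theorem qDelta_ne_zero (hq0 : 0 < q) (hq1 : q < 1) : qDelta q ≠ 0 := by
  have : (Real.log q : ℂ) ≠ 0 := ofReal_ne_zero.2 (Real.log_neg hq0 hq1).ne
  simp [qDelta, Real.pi_ne_zero, this]

/-- The nonzero values among `t + δn + j`, `0 ≤ j < m`, are bounded away from zero. -/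
theorem exists_forall_le_norm_add_qDelta (hq0 : 0 < q) (hq1 : q < 1) (t : ℂ) (m : ℕ) :
    ∃ η > 0, ∀ (n : ℤ), ∀ j < m, t + qDelta q * (n : ℂ) + (j : ℂ) ≠ 0 →
      η ≤ ‖t + qDelta q * (n : ℂ) + (j : ℂ)‖ := by
  have hδ : 0 < ‖qDelta q‖ := norm_pos_iff.2 (qDelta_ne_zero hq0 hq1)
  -- For `|n| ≥ N` the term `δn` dominates and the norm exceeds `1`; the finitely many other pairs
  -- `(n,j)` are met by taking `η` small.
  obtain ⟨N, hN⟩ := exists_nat_gt ((1 + ‖t‖ + m) / ‖qDelta q‖)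
  rw [div_lt_iff₀ hδ] at hN
  have h1 : ∀ᶠ η in 𝓝[>] (0 : ℝ), η ≤ 1 := by
    filter_upwards [Ioc_mem_nhdsGT (zero_lt_one' ℝ)] with η hη using hη.2
  have h2 : ∀ᶠ η in 𝓝[>] (0 : ℝ), ∀ n ∈ Finset.Icc (-N : ℤ) N, ∀ j ∈ Finset.range m,
      t + qDelta q * (n : ℂ) + (j : ℂ) ≠ 0 → η ≤ ‖t + qDelta q * (n : ℂ) + (j : ℂ)‖ := by
    refine (Filter.eventually_all_finset _).2 fun n _ => (Filter.eventually_all_finset _).2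
      fun j _ => ?_
    by_cases h : t + qDelta q * (n : ℂ) + (j : ℂ) = 0
    · simp [h]
    · filter_upwards [Ioc_mem_nhdsGT (norm_pos_iff.2 h)] with η hη _ using hη.2
  obtain ⟨η, ⟨hη1, hη2⟩, hη0⟩ := ((h1.and h2).and self_mem_nhdsWithin).exists
  refine ⟨η, hη0, fun n j hj h => ?_⟩
  by_cases hn : n ∈ Finset.Icc (-N : ℤ) N
  · exact hη2 n hn j (Finset.mem_range.2 hj) h
  · have hn' : (N : ℤ) ≤ |n| := by
      rw [Finset.mem_Icc] at hn
      by_contra! hlt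
      exact hn ⟨by linarith [neg_abs_le n], by linarith [le_abs_self n]⟩
    have hn'' : (N : ℝ) ≤ ‖(n : ℂ)‖ := by
      rw [norm_intCast]
      exact_mod_cast hn'
    have e : qDelta q * (n : ℂ) = (t + qDelta q * (n : ℂ) + (j : ℂ)) - t - j := by ring
    have e1 := congrArg norm e
    rw [norm_mul] at e1
    have e2 := norm_sub_le ((t + qDelta q * (n : ℂ) + (j : ℂ)) - t) j
    have e3 := norm_sub_le (t + qDelta q * (n : ℂ) + (j : ℂ)) t
    rw [norm_natCast] at e2
    have hj' : (j : ℝ) ≤ m := by exact_mod_cast hj.le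
    nlinarith

/-- The real part determines `j`, because `δ` is imaginary, and then `n` follows. So a pole comes
from a single factor, which is why it is simple. -/
theorem add_qDelta_mul_eq_zero (hq0 : 0 < q) (hq1 : q < 1) {n n' : ℤ} {j j' : ℕ}
    (h : -(j : ℂ) - qDelta q * (n : ℂ) + qDelta q * (n' : ℂ) + (j' : ℂ) = 0) :
    n' = n ∧ j' = j := by
  have h1 := congrArg re h
  have hn := qDelta_mul_intCast_re q n
  have hn' := qDelta_mul_intCast_re q n'
  simp only [add_re, sub_re, neg_re, natCast_re, zero_re, hn, hn'] at h1
  have hj : j' = j := by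
    have : (j' : ℝ) = j := by linarith
    exact_mod_cast this
  subst hj
  have h2 : qDelta q * ((n' : ℂ) - n) = 0 := by linear_combination h
  rcases mul_eq_zero.1 h2 with h3 | h3
  · exact absurd h3 (qDelta_ne_zero hq0 hq1)
  · exact ⟨by exact_mod_cast sub_eq_zero.1 h3, rfl⟩

end

/-! ### Series of continued beta functions: convergence and poles -/

/-- The series `∑ c_n b_x(t + δn, β)` of continued incomplete beta functions, as a function of
`(t, β)`. -/
noncomputable def incBetaContSum (q : ℝ) (M : ℕ) (x : ℝ) (c : ℤ → ℂ) (p : ℂ × ℂ) : ℂ :=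
  ∑' n : ℤ, c n * incBetaCont M x (p.1 + qDelta q * (n : ℂ)) p.2

section

variable {q x : ℝ} {M : ℕ} {c : ℤ → ℂ}

/-- Nonvanishing is required only where `c n ≠ 0`, so that the lemma still applies at a pole once
the singular term has been deleted. -/
theorem exists_ball_norm_incBetaCont_le (hq0 : 0 < q) (hq1 : q < 1) (hx0 : 0 < x) (hx1 : x < 1)
    {p : ℂ × ℂ} (hp : 1 - (M : ℝ) < p.1.re)
    (h : ∀ n, c n ≠ 0 → ∀ j < M - 1, p.1 + qDelta q * (n : ℂ) + (j : ℂ) ≠ 0) :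
    ∃ r > 0, ∃ C : ℝ, ∀ n, c n ≠ 0 → ∀ y ∈ Metric.ball p r,
      1 - (M : ℝ) < y.1.re ∧ (∀ j < M - 1, y.1 + qDelta q * (n : ℂ) + (j : ℂ) ≠ 0) ∧
      ‖incBetaCont M x (y.1 + qDelta q * (n : ℂ)) y.2‖ ≤ C := by
  obtain ⟨η, hη, hη'⟩ := exists_forall_le_norm_add_qDelta hq0 hq1 p.1 (M - 1)
  -- Moving by `η/2` leaves each factor at least `η/2`; the second entry keeps `Re t > 1 - M`.
  set r := min (η / 2) ((p.1.re - (1 - M)) / 2) with hr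
  have hr0 : 0 < r := lt_min (by positivity) (by linarith)
  have hr1 : r ≤ η / 2 := min_le_left _ _
  have hr2 : r ≤ (p.1.re - (1 - M)) / 2 := min_le_right _ _
  obtain ⟨C, hC⟩ := exists_norm_incBetaCont_le (M := M) hx0 hx1 (p.2.re - r) (‖1 - p.2‖ + r)
    (show 1 - (M : ℝ) < p.1.re - r by linarith) (show 0 < η / 2 by positivity)
  refine ⟨r, hr0, C, fun n hn y hy => ?_⟩
  rw [Metric.mem_ball, dist_eq_norm] at hy
  have h1 : ‖y.1 - p.1‖ ≤ r := (norm_fst_le (y - p)).trans hy.le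
  have h2 : ‖y.2 - p.2‖ ≤ r := (norm_snd_le (y - p)).trans hy.le
  have h1' := (abs_le.1 ((abs_re_le_norm _).trans h1)).1
  have h2' := (abs_le.1 ((abs_re_le_norm _).trans h2)).1
  rw [sub_re] at h1' h2'
  have hle : ∀ j < M - 1, η / 2 ≤ ‖y.1 + qDelta q * (n : ℂ) + (j : ℂ)‖ := by
    intro j hj
    have e := norm_sub_le (y.1 + qDelta q * (n : ℂ) + (j : ℂ)) (y.1 - p.1)
    rw [show y.1 + qDelta q * (n : ℂ) + (j : ℂ) - (y.1 - p.1) =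
      p.1 + qDelta q * (n : ℂ) + (j : ℂ) by ring] at e
    linarith [hη' n j hj (h n hn j hj)]
  refine ⟨by linarith, fun j hj => norm_pos_iff.1 (by linarith [hle j hj]),
    hC _ _ ?_ (by linarith) ?_ hle⟩
  · rw [add_re, qDelta_mul_intCast_re]
    linarith
  · have e := norm_sub_le (1 - p.2) (y.2 - p.2)
    rw [show 1 - p.2 - (y.2 - p.2) = 1 - y.2 by ring] at e
    linarith

theorem summable_norm_mul_incBetaCont (hq0 : 0 < q) (hq1 : q < 1) (hx0 : 0 < x) (hx1 : x < 1)
    (hc : Summable fun n => ‖c n‖) {t : ℂ} (ht : 1 - (M : ℝ) < t.re)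
    (h : ∀ n, c n ≠ 0 → ∀ j < M - 1, t + qDelta q * (n : ℂ) + (j : ℂ) ≠ 0) (β : ℂ) :
    Summable fun n => ‖c n * incBetaCont M x (t + qDelta q * (n : ℂ)) β‖ := by
  obtain ⟨r, hr, C, hC⟩ := exists_ball_norm_incBetaCont_le hq0 hq1 hx0 hx1 (p := (t, β)) ht h
  refine Summable.of_nonneg_of_le (fun _ => norm_nonneg _) (fun n => ?_) (hc.mul_right C)
  rw [norm_mul]
  by_cases hn : c n = 0
  · simp [hn]
  · gcongr
    exact (hC n hn _ (Metric.mem_ball_self hr)).2.2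

theorem differentiableAt_incBetaContSum (hq0 : 0 < q) (hq1 : q < 1) (hx0 : 0 < x) (hx1 : x < 1)
    (hc : Summable fun n => ‖c n‖) {p : ℂ × ℂ} (hp : 1 - (M : ℝ) < p.1.re)
    (h : ∀ n, c n ≠ 0 → ∀ j < M - 1, p.1 + qDelta q * (n : ℂ) + (j : ℂ) ≠ 0) :
    DifferentiableAt ℂ (incBetaContSum q M x c) p := by
  obtain ⟨r, hr, C, hC⟩ := exists_ball_norm_incBetaCont_le hq0 hq1 hx0 hx1 hp h
  refine differentiableAt_tsum_of_norm_le_on_ball hr (hc.mul_right C) (fun n => ?_) fun n y hy => ?_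
  · by_cases hn : c n = 0
    · simp [hn]
    refine fun y hy => DifferentiableAt.differentiableWithinAt ?_
    have hCy := hC n hn y hy
    refine DifferentiableAt.const_mul (DifferentiableAt.comp
      (g := fun p : ℂ × ℂ => incBetaCont M x p.1 p.2)
      (f := fun y : ℂ × ℂ => (y.1 + qDelta q * (n : ℂ), y.2)) y
      (differentiableAt_incBetaCont hx0 hx1 ?_ hCy.2.1) (by fun_prop)) _
    simpa [qDelta_re] using hCy.1
  · rw [norm_mul]
    by_cases hn : c n = 0
    · simp [hn]
    · gcongr
      exact (hC n hn y hy).2.2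

theorem add_qDelta_ne_zero_of_notMem_qPoles {t : ℂ} (h : t ∉ qPoles q M) (n : ℤ) {j : ℕ}
    (hj : j < M - 1) : t + qDelta q * (n : ℂ) + (j : ℂ) ≠ 0 := fun h0 =>
  h ⟨n, j, by omega, by linear_combination h0⟩

/-- The series has at most simple poles, on a neighbourhood independent of the coefficients. -/
theorem exists_isOpen_incBetaContSum_eq_div (hq0 : 0 < q) (hq1 : q < 1) (hx0 : 0 < x)
    (hx1 : x < 1) {t₀ : ℂ} (ht₀ : t₀ ∈ qPoles q M) :
    ∃ U : Set ℂ, IsOpen U ∧ t₀ ∈ U ∧ ∀ c : ℤ → ℂ, (Summable fun n => ‖c n‖) →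
      ∃ G : ℂ × ℂ → ℂ, (∀ p : ℂ × ℂ, p.1 ∈ U → DifferentiableAt ℂ G p) ∧
        ∀ t ∈ U, t ≠ t₀ → ∀ β, (t - t₀) * incBetaContSum q M x c (t, β) = G (t, β) := by
  obtain ⟨n₀, j₀, hj₀, rfl⟩ := ht₀
  set t₀ : ℂ := -(j₀ : ℂ) - qDelta q * (n₀ : ℂ) with ht₀
  obtain ⟨η, hη, hη'⟩ := exists_forall_le_norm_add_qDelta hq0 hq1 t₀ (M - 1)
  have hre : t₀.re = -(j₀ : ℝ) := by
    rw [ht₀, sub_re, qDelta_mul_intCast_re]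
    simp
  have hj₀' : (j₀ : ℝ) + 2 ≤ M := by exact_mod_cast hj₀
  -- Radius `η` prevents every factor other than `(n₀, j₀)` from vanishing; radius `1` suffices for
  -- `Re t > 1 - M` since `Re t₀ = -j₀ ≥ 2 - M`.
  set r := min η 1 with hr
  have hr1 : r ≤ η := min_le_left _ _
  have hr2 : r ≤ 1 := min_le_right _ _
  have hUre : ∀ t ∈ Metric.ball t₀ r, 1 - (M : ℝ) < t.re := by
    intro t ht
    rw [Metric.mem_ball, dist_eq_norm] at ht
    have := (abs_lt.1 ((abs_re_le_norm _).trans_lt ht)).1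
    rw [sub_re] at this
    linarith
  have hUne : ∀ t ∈ Metric.ball t₀ r, ∀ (n : ℤ), ∀ j < M - 1, ¬ (n = n₀ ∧ j = j₀) →
      t + qDelta q * (n : ℂ) + (j : ℂ) ≠ 0 := by
    intro t ht n j hj hnj h0
    rw [Metric.mem_ball, dist_eq_norm] at ht
    have h1 := hη' n j hj fun h => hnj (add_qDelta_mul_eq_zero hq0 hq1 h)
    rw [show t₀ + qDelta q * (n : ℂ) + (j : ℂ) = -(t - t₀) by linear_combination h0,
      norm_neg] at h1
    linarith
  refine ⟨Metric.ball t₀ r, Metric.isOpen_ball, Metric.mem_ball_self (by positivity),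
    fun c hc => ?_⟩
  -- Deleting the `n₀`-th coefficient leaves a series holomorphic near `t₀`.
  set c' : ℤ → ℂ := fun n => if n = n₀ then 0 else c n with hc'
  have hc's : Summable fun n => ‖c' n‖ := by
    refine hc.of_nonneg_of_le (fun _ => norm_nonneg _) fun n => ?_
    simp only [hc']
    split_ifs <;> simp
  have hc'0 : ∀ n, c' n ≠ 0 → n ≠ n₀ := by
    rintro n hn rfl
    simp [hc'] at hn
  -- `(α)_{M-1}` without the factor `α + j₀`, which equals `t - t₀` at `α = t + δn₀`.
  set P : ℂ → ℂ := fun α => ∏ j ∈ (Finset.range (M - 1)).erase j₀, (α + (j : ℂ)) with hP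
  have hPd : Differentiable ℂ P := by
    rw [hP]
    fun_prop
  have hP0 : ∀ t ∈ Metric.ball t₀ r, P (t + qDelta q * (n₀ : ℂ)) ≠ 0 := by
    intro t ht
    refine Finset.prod_ne_zero_iff.2 fun j hj => ?_
    rw [Finset.mem_erase, Finset.mem_range] at hj
    exact hUne t ht n₀ j hj.2 fun h => hj.1 h.2
  have hrf : ∀ α : ℂ, risingFact α (M - 1) = (α + j₀) * P α := fun α =>
    (Finset.mul_prod_erase _ (fun j : ℕ => α + (j : ℂ)) (Finset.mem_range.2 (by omega))).symm
  refine ⟨fun p => (p.1 - t₀) * incBetaContSum q M x c' p + c n₀ *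
    (incBetaNum M x (p.1 + qDelta q * (n₀ : ℂ), p.2) / P (p.1 + qDelta q * (n₀ : ℂ))), ?_, ?_⟩
  · intro p hp
    refine DifferentiableAt.add (DifferentiableAt.mul (by fun_prop)
      (differentiableAt_incBetaContSum hq0 hq1 hx0 hx1 hc's (hUre _ hp) fun n hn j hj =>
        hUne _ hp n j hj fun h => hc'0 n hn h.1)) (DifferentiableAt.const_mul
        (DifferentiableAt.div_of_ne_zero ?_ ?_ ?_) _)
    · refine DifferentiableAt.comp (g := incBetaNum M x)
        (f := fun p : ℂ × ℂ => (p.1 + qDelta q * (n₀ : ℂ), p.2)) p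
        (differentiableAt_incBetaNum hx0 hx1 ?_) (by fun_prop)
      simpa [qDelta_re] using hUre _ hp
    · exact hPd.differentiableAt.comp p (by fun_prop)
    · exact hP0 _ hp
  · intro t ht htne β
    have hne : t + qDelta q * (n₀ : ℂ) + (j₀ : ℂ) ≠ 0 := fun h =>
      htne (by rw [ht₀]; linear_combination h)
    have hs := summable_norm_mul_incBetaCont hq0 hq1 hx0 hx1 hc (hUre t ht) (fun n _ j hj => by
      by_cases h : n = n₀ ∧ j = j₀
      · rw [h.1, h.2]
        exact hne
      · exact hUne t ht n j hj h) β
    have hsum : incBetaContSum q M x c (t, β) =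
        c n₀ * incBetaCont M x (t + qDelta q * (n₀ : ℂ)) β + incBetaContSum q M x c' (t, β) := by
      rw [incBetaContSum, hs.of_norm.tsum_eq_add_tsum_ite n₀]
      congr 1
      refine tsum_congr fun n => ?_
      simp only [hc']
      split_ifs <;> simp
    have h0 : risingFact (t + qDelta q * (n₀ : ℂ)) (M - 1) ≠ 0 := by
      rw [hrf]
      exact mul_ne_zero hne (hP0 t ht)
    have hP0' := hP0 t ht
    have e : t - t₀ = t + qDelta q * (n₀ : ℂ) + (j₀ : ℂ) := by rw [ht₀]; ring
    rw [hsum, incBetaCont_eq_div h0, hrf]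
    simp only [e]
    field_simp
    ring

end

/-! ### The kernel and the substitution `u = q^{x+a}` -/

/-- The function `e^{2πinx} q^{(x+a)t} [x+a]_q^{-σ}`. -/
noncomputable def qKernel (q a : ℝ) (σ t : ℂ) (n : ℤ) (x : ℝ) : ℂ :=
  exp (2 * (Real.pi : ℂ) * I * (n : ℂ) * (x : ℂ)) * (q : ℂ) ^ (((x : ℂ) + (a : ℂ)) * t) *
    (((1 - q ^ (x + a)) / (1 - q) : ℝ) : ℂ) ^ (-σ)

theorem qFourierIntegrand_eq_qKernel (q a : ℝ) (M : ℕ) (s t : ℂ) (ε : Fin 3) (n : ℤ) :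
    qFourierIntegrand q a M s t ε n = qKernel q a (s + ((ε : ℕ) : ℂ) + M - 1) (t + M - 1) n := by
  funext x
  rw [qFourierIntegrand, qKernel]
  congr 2
  ring

section

variable {q a : ℝ}

theorem rpow_pos_and_lt_one (hq0 : 0 < q) (hq1 : q < 1) (ha0 : 0 < a) : 0 < q ^ a ∧ q ^ a < 1 :=
  ⟨Real.rpow_pos_of_pos hq0 a, Real.rpow_lt_one hq0.le hq1 ha0⟩

theorem image_rpow_add_Ioi (hq0 : 0 < q) (hq1 : q < 1) :
    (fun x : ℝ => q ^ (x + a)) '' Ioi 0 = Ioo 0 (q ^ a) := by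
  have hL := Real.log_neg hq0 hq1
  ext u
  constructor
  · rintro ⟨x, hx, rfl⟩
    exact ⟨Real.rpow_pos_of_pos hq0 _,
      Real.rpow_lt_rpow_of_exponent_gt hq0 hq1 (by linarith [mem_Ioi.1 hx])⟩
  · rintro ⟨hu0, hu1⟩
    refine ⟨Real.log u / Real.log q - a, ?_, ?_⟩
    · have := Real.log_lt_log hu0 hu1
      rw [Real.log_rpow hq0] at this
      rw [mem_Ioi, sub_pos, lt_div_iff_of_neg hL]
      exact this
    · simp only [sub_add_cancel]
      rw [Real.rpow_def_of_pos hq0, mul_div_cancel₀ _ hL.ne, Real.exp_log hu0]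

theorem log_mul_qDelta (hq0 : 0 < q) (hq1 : q < 1) :
    (Real.log q : ℂ) * qDelta q = 2 * Real.pi * I := by
  have : (Real.log q : ℂ) ≠ 0 := ofReal_ne_zero.2 (Real.log_neg hq0 hq1).ne
  rw [qDelta, mul_div_cancel₀ _ this]

theorem ofReal_cpow_eq_exp (hq0 : 0 < q) (z : ℂ) : (q : ℂ) ^ z = exp (Real.log q * z) := by
  rw [cpow_def_of_ne_zero (ofReal_ne_zero.2 hq0.ne'), ofReal_log hq0.le]

theorem ofReal_rpow_cpow (hq0 : 0 < q) (y : ℝ) (z : ℂ) :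
    ((q ^ y : ℝ) : ℂ) ^ z = exp (Real.log q * (y * z)) := by
  rw [ofReal_cpow_eq_exp (Real.rpow_pos_of_pos hq0 y), Real.log_rpow hq0]
  push_cast
  ring_nf

theorem div_ofReal_cpow_neg {u v : ℝ} (hu : 0 < u) (hv : 0 < v) (σ : ℂ) :
    ((u / v : ℝ) : ℂ) ^ (-σ) = (u : ℂ) ^ (-σ) * (v : ℂ) ^ σ := by
  rw [ofReal_cpow_eq_exp (div_pos hu hv), ofReal_cpow_eq_exp hu, ofReal_cpow_eq_exp hv,
    Real.log_div hu.ne' hv.ne', ← exp_add]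
  push_cast
  ring_nf

/-- By the choice of `δ`, `u^{δn} = e^{2πin(x+a)}` for `u = q^{x+a}`: the oscillation becomes a
shift of the exponent, with the phase `e^{-2πina}` left over. The absolute value is the Jacobian. -/
theorem qKernel_eq_smul_incBetaIntegrand (hq0 : 0 < q) (hq1 : q < 1) (ha0 : 0 < a) (σ t : ℂ)
    (n : ℤ) {x : ℝ} (hx : 0 ≤ x) :
    qKernel q a σ t n x = -(exp (-(2 * Real.pi * I * n * a)) * ((1 - q : ℝ) : ℂ) ^ σ /
      Real.log q) * (|q ^ (x + a) * Real.log q| •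
        incBetaIntegrand (t + qDelta q * n) (1 - σ) (q ^ (x + a))) := by
  have hL := Real.log_neg hq0 hq1
  have hL0 : (Real.log q : ℂ) ≠ 0 := ofReal_ne_zero.2 hL.ne
  obtain ⟨hu0, hu1⟩ := rpow_pos_and_lt_one hq0 hq1 (show 0 < x + a by linarith)
  rw [abs_of_neg (mul_neg_of_pos_of_neg hu0 hL), incBetaIntegrand, qKernel,
    div_ofReal_cpow_neg (sub_pos.2 hu1) (sub_pos.2 hq1), ofReal_rpow_cpow hq0,
    ofReal_cpow_eq_exp hq0, real_smul, sub_sub_cancel_left]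
  have hq' : ((q ^ (x + a) : ℝ) : ℂ) = exp (Real.log q * (x + a)) := by
    rw [Real.rpow_def_of_pos hq0]
    push_cast
    rfl
  have e : exp (Real.log q * (x + a)) * exp (Real.log q * (((x + a : ℝ) : ℂ) *
      (t + qDelta q * n - 1))) * exp (-(2 * Real.pi * I * n * a)) =
      exp (2 * Real.pi * I * n * x) * exp (Real.log q * ((x + a) * t)) := by
    rw [← exp_add, ← exp_add, ← exp_add]
    congr 1
    push_cast
    linear_combination (n * (x + a)) * log_mul_qDelta hq0 hq1
  rw [← e, ofReal_neg, ofReal_mul, hq']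
  field_simp

theorem hasDerivAt_rpow_add (hq0 : 0 < q) (x : ℝ) :
    HasDerivAt (fun x : ℝ => q ^ (x + a)) (q ^ (x + a) * Real.log q) x := by
  simpa [mul_comm] using ((hasDerivAt_id x).add_const a).const_rpow hq0

theorem injOn_rpow_add (hq0 : 0 < q) (hq1 : q < 1) (s : Set ℝ) :
    InjOn (fun x : ℝ => q ^ (x + a)) s := by
  have h : StrictAnti fun x : ℝ => q ^ (x + a) := fun x y hxy =>
    Real.rpow_lt_rpow_of_exponent_gt hq0 hq1 (by linarith)
  exact h.injective.injOn

theorem integrableOn_qKernel (hq0 : 0 < q) (hq1 : q < 1) (ha0 : 0 < a) (σ : ℂ) {t : ℂ}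
    (ht : 0 < t.re) (n : ℤ) : IntegrableOn (qKernel q a σ t n) (Ioi 0) := by
  obtain ⟨hu0, hu1⟩ := rpow_pos_and_lt_one hq0 hq1 ha0
  have h1 := intervalIntegrable_incBetaIntegrand hu0 hu1 (α := t + qDelta q * n)
    (by rwa [add_re, qDelta_mul_intCast_re, add_zero]) (1 - σ)
  rw [intervalIntegrable_iff_integrableOn_Ioo_of_le hu0.le, ← image_rpow_add_Ioi hq0 hq1,
    integrableOn_image_iff_integrableOn_abs_deriv_smul measurableSet_Ioi
      (fun x _ => (hasDerivAt_rpow_add hq0 x).hasDerivWithinAt) (injOn_rpow_add hq0 hq1 _)] at h1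
  refine IntegrableOn.congr_fun (h1.const_mul (-(exp (-(2 * Real.pi * I * n * a)) *
    ((1 - q : ℝ) : ℂ) ^ σ / Real.log q))) (fun x hx => ?_) measurableSet_Ioi
  exact (qKernel_eq_smul_incBetaIntegrand hq0 hq1 ha0 σ t n (mem_Ioi.1 hx).le).symm

theorem integral_qKernel (hq0 : 0 < q) (hq1 : q < 1) (ha0 : 0 < a) (σ t : ℂ) (n : ℤ) :
    ∫ x in Ioi (0 : ℝ), qKernel q a σ t n x =
      -(exp (-(2 * Real.pi * I * n * a)) * ((1 - q : ℝ) : ℂ) ^ σ / Real.log q) *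
        incBeta (q ^ a) (t + qDelta q * n) (1 - σ) := by
  obtain ⟨hu0, hu1⟩ := rpow_pos_and_lt_one hq0 hq1 ha0
  rw [incBeta, intervalIntegral.integral_of_le hu0.le, integral_Ioc_eq_integral_Ioo,
    ← image_rpow_add_Ioi hq0 hq1, integral_image_eq_integral_abs_deriv_smul measurableSet_Ioi
      (fun x _ => (hasDerivAt_rpow_add hq0 x).hasDerivWithinAt) (injOn_rpow_add hq0 hq1 _),
    ← integral_const_mul]
  refine setIntegral_congr_fun measurableSet_Ioi fun x hx => ?_
  exact qKernel_eq_smul_incBetaIntegrand hq0 hq1 ha0 σ t n (mem_Ioi.1 hx).le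

/-- The Fourier coefficients `e^{-2πina} / (2πin)^2`. -/
noncomputable def qFourierWeight (a : ℝ) (n : ℤ) : ℂ :=
  1 / (2 * Real.pi * I * n) ^ 2 * exp (-(2 * Real.pi * I * n * a))

theorem summable_one_div_two_pi_I_mul_sq :
    Summable fun n : ℤ => ‖1 / (2 * (Real.pi : ℂ) * I * n) ^ 2‖ := by
  have h := (Real.summable_one_div_int_pow.2 (one_lt_two)).mul_left (1 / (2 * Real.pi) ^ 2)
  refine h.congr fun n => ?_
  have : ‖(n : ℂ)‖ ^ 2 = (n : ℝ) ^ 2 := by rw [norm_intCast, sq_abs]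
  rw [norm_div, norm_pow, norm_mul, mul_pow ‖_‖, this]
  simp [abs_of_pos Real.pi_pos, mul_comm]

theorem norm_exp_two_pi_I_mul (n : ℤ) (x : ℝ) :
    ‖exp (2 * (Real.pi : ℂ) * I * (n : ℂ) * (x : ℂ))‖ = 1 := by
  rw [show 2 * (Real.pi : ℂ) * I * (n : ℂ) * (x : ℂ) = ((2 * Real.pi * n * x : ℝ) : ℂ) * I by
    push_cast; ring, norm_exp_ofReal_mul_I]

theorem summable_qFourierWeight (a : ℝ) : Summable fun n => ‖qFourierWeight a n‖ := by
  refine summable_one_div_two_pi_I_mul_sq.congr fun n => ?_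
  have := norm_exp_two_pi_I_mul n (-a)
  rw [ofReal_neg, mul_neg] at this
  rw [qFourierWeight, norm_mul, this, mul_one]

/-- The integral in the term is itself a beta function with parameters shifted by `M-1`, so the
bracket is the integrated-by-parts formula at `α = t + δn`, `β = 1 - s - ε`. -/
theorem qFourierTerm_eq (hq0 : 0 < q) (hq1 : q < 1) (ha0 : 0 < a) {M : ℕ} (hM : 1 ≤ M)
    (s t : ℂ) (ε : Fin 3) (n : ℤ) :
    qFourierTerm q a M s t ε n = ((1 - q : ℝ) : ℂ) ^ s * ((1 - q ^ a : ℝ) : ℂ) ^ (ε : ℕ) /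
      ((1 - q ^ a : ℝ) : ℂ) * (qFourierWeight a n *
        incBetaCont M (q ^ a) (t + qDelta q * n) (1 - s - ((ε : ℕ) : ℂ))) := by
  obtain ⟨hu0, hu1⟩ := rpow_pos_and_lt_one hq0 hq1 ha0
  have hw : 0 < 1 - q ^ a := sub_pos.2 hu1
  have hv : 0 < 1 - q := sub_pos.2 hq1
  have hL0 : (Real.log q : ℂ) ≠ 0 := ofReal_ne_zero.2 (Real.log_neg hq0 hq1).ne
  have hx : ∀ l : ℕ, ((q ^ a : ℝ) : ℂ) ^ (t + qDelta q * n + l - 1) =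
      exp (2 * Real.pi * I * n * a) * (q : ℂ) ^ ((a : ℂ) * (t + l - 1)) := by
    intro l
    rw [ofReal_rpow_cpow hq0, ofReal_cpow_eq_exp hq0, ← exp_add]
    congr 1
    linear_combination (n * a) * log_mul_qDelta hq0 hq1
  rw [qFourierTerm, qFourierIntegrand_eq_qKernel, integral_qKernel hq0 hq1 ha0, incBetaCont,
    div_ofReal_cpow_neg hw hv, qFourierWeight, exp_neg]
  simp only [hx]
  set w : ℝ := 1 - q ^ a with hw'
  set v : ℝ := 1 - q with hv'
  have hw0 : (w : ℂ) ≠ 0 := ofReal_ne_zero.2 hw.ne'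
  have hv0 : (v : ℂ) ≠ 0 := ofReal_ne_zero.2 hv.ne'
  have hE := exp_ne_zero (2 * Real.pi * I * n * a)
  set E := exp (2 * Real.pi * I * n * a) with hE'
  have hwl : ∀ l : ℕ, (w : ℂ) ^ (1 - s - ((ε : ℕ) : ℂ) - l) =
      (w : ℂ) ^ (-s) * w / ((w : ℂ) ^ (ε : ℕ) * (w : ℂ) ^ l) := by
    intro l
    rw [show 1 - s - ((ε : ℕ) : ℂ) - l = -s + 1 - ((ε : ℕ) : ℂ) - l by ring, cpow_sub _ _ hw0,
      cpow_sub _ _ hw0, cpow_add _ _ hw0, cpow_one, cpow_natCast, cpow_natCast, div_div]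
  have hvM : (v : ℂ) ^ (s + ((ε : ℕ) : ℂ) + M - 1) =
      (v : ℂ) ^ s * (v : ℂ) ^ (ε : ℕ) * (v : ℂ) ^ (M - 1) := by
    rw [show s + ((ε : ℕ) : ℂ) + M - 1 = s + ((ε : ℕ) : ℂ) + ((M - 1 : ℕ) : ℂ) by
      rw [Nat.cast_sub hM]; push_cast; ring, cpow_add _ _ hv0, cpow_add _ _ hv0, cpow_natCast,
      cpow_natCast]
  rw [hvM, show t + (M : ℂ) - 1 + qDelta q * n = t + qDelta q * n + M - 1 by ring,
    show 1 - (s + ((ε : ℕ) : ℂ) + M - 1) = 1 - s - ((ε : ℕ) : ℂ) - M + 1 by ring,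
    show 1 - (1 - s - ((ε : ℕ) : ℂ)) = s + ((ε : ℕ) : ℂ) by ring]
  simp only [hwl]
  rw [mul_add, mul_add, mul_sub, sub_eq_add_neg]
  congr 1
  · simp only [Finset.mul_sum]
    refine Finset.sum_congr rfl fun l _ => ?_
    field_simp
  · push_cast
    rw [div_pow]
    field_simp

theorem qFourierCTilde_eq (hq0 : 0 < q) (hq1 : q < 1) (ha0 : 0 < a) {M : ℕ} (hM : 1 ≤ M)
    (s t : ℂ) (ε : Fin 3) :
    qFourierCTilde q a M s t ε = 2 * ((1 - q : ℝ) : ℂ) ^ s / (Real.log q : ℂ) * qCoeff q s t ε *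
      incBetaContSum q M (q ^ a) (qFourierWeight a) (t, 1 - s - ((ε : ℕ) : ℂ)) := by
  have hw : ((1 - q ^ a : ℝ) : ℂ) ≠ 0 :=
    ofReal_ne_zero.2 (sub_pos.2 (rpow_pos_and_lt_one hq0 hq1 ha0).2).ne'
  rw [qFourierCTilde, qFourierC, incBetaContSum]
  simp only [qFourierTerm_eq hq0 hq1 ha0 hM]
  rw [tsum_mul_left, zpow_sub₀ hw, zpow_one, zpow_natCast]
  -- The sum extends to all integers because the weight at `n = 0` is `1/0 = 0`.
  have e : ∑' n : {n : ℤ // n ≠ 0}, qFourierWeight a n *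
      incBetaCont M (q ^ a) (t + qDelta q * ((n : ℤ) : ℂ)) (1 - s - ((ε : ℕ) : ℂ)) =
      ∑' n : ℤ, qFourierWeight a n *
        incBetaCont M (q ^ a) (t + qDelta q * (n : ℂ)) (1 - s - ((ε : ℕ) : ℂ)) := by
    refine tsum_subtype_eq_of_support_subset (s := {n : ℤ | n ≠ 0})
      (f := fun n : ℤ => qFourierWeight a n *
        incBetaCont M (q ^ a) (t + qDelta q * (n : ℂ)) (1 - s - ((ε : ℕ) : ℂ))) ?_
    intro n hn h0
    simp [qFourierWeight, h0] at hn
  rw [e]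
  field_simp

end

/-! ### Second-order Euler–Maclaurin summation with Fourier remainder -/

/-- The function `∑_{n ≠ 0} e^{2πinx} / (2πin)^2`. -/
noncomputable def fourierBernoulliTwo (x : ℝ) : ℂ :=
  ∑' n : ℤ, 1 / (2 * (Real.pi : ℂ) * I * n) ^ 2 * exp (2 * (Real.pi : ℂ) * I * n * x)

theorem norm_fourierBernoulliTwo_term (n : ℤ) (x : ℝ) :
    ‖1 / (2 * (Real.pi : ℂ) * I * n) ^ 2 * exp (2 * (Real.pi : ℂ) * I * n * x)‖ =
      ‖1 / (2 * (Real.pi : ℂ) * I * n) ^ 2‖ := by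
  rw [norm_mul, norm_exp_two_pi_I_mul, mul_one]

theorem continuous_fourierBernoulliTwo : Continuous fourierBernoulliTwo :=
  continuous_tsum (fun n => by fun_prop) summable_one_div_two_pi_I_mul_sq
    fun n x => (norm_fourierBernoulliTwo_term n x).le

/-- The Fourier expansion of `-B₂(x-k)/2`, moved to `[k,k+1]` by periodicity; order two makes it
valid at both endpoints. -/
theorem fourierBernoulliTwo_eq (k : ℕ) {x : ℝ} (hx : x ∈ Icc (k : ℝ) (k + 1)) :
    fourierBernoulliTwo x = -(1 / 2) * (((x : ℂ) - k) ^ 2 - (x - k) + 1 / 6) := by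
  have hx' : x - k ∈ Icc (0 : ℝ) 1 := ⟨by linarith [hx.1], by linarith [hx.2]⟩
  have h := (hasSum_one_div_pow_mul_fourier_mul_bernoulliFun le_rfl hx').mul_left
    (1 / (2 * (Real.pi : ℂ) * I) ^ 2)
  have hpi : (2 * (Real.pi : ℂ) * I) ≠ 0 := two_pi_I_ne_zero
  refine (HasSum.tsum_eq (h.congr_fun fun n => ?_)).trans ?_
  · rw [fourier_coe_apply, mul_pow _ (n : ℂ), one_div_mul_eq_div, ← mul_assoc]
    have e : exp (2 * Real.pi * I * n * ((x - k : ℝ) : ℂ) / ((1 : ℝ) : ℂ)) =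
        exp (2 * Real.pi * I * n * x) := by
      rw [exp_eq_exp_iff_exists_int]
      refine ⟨-(n * k), ?_⟩
      push_cast
      ring
    rw [e]
    field_simp
  · rw [bernoulliFun_two]
    push_cast
    field_simp
    simp [Nat.factorial]

/-- The Euler–Maclaurin summation formula of order two, with the remainder expanded into a Fourier
series. -/
theorem tsum_eq_integral_add_tsum_fourier {f f' f'' : ℝ → ℂ}
    (hf : ∀ x, 0 ≤ x → HasDerivAt f (f' x) x) (hf' : ∀ x, 0 ≤ x → HasDerivAt f' (f'' x) x)
    (hc : ContinuousOn f'' (Ici 0)) (hi : IntegrableOn f (Ioi 0)) (hi'' : IntegrableOn f'' (Ioi 0))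
    (hs : Summable fun n : ℕ => f n) (hs' : Tendsto (fun n : ℕ => f' n) atTop (𝓝 0)) :
    ∑' n : ℕ, f n = (∫ x in Ioi (0 : ℝ), f x) + f 0 / 2 - f' 0 / 12 +
      ∑' n : ℤ, 1 / (2 * (Real.pi : ℂ) * I * n) ^ 2 *
        ∫ x in Ioi (0 : ℝ), exp (2 * (Real.pi : ℂ) * I * n * x) * f'' x := by
  have hcf : ContinuousOn f (Ici 0) := fun x hx => (hf x hx).continuousAt.continuousWithinAt
  have hbd : ∀ x, ‖fourierBernoulliTwo x‖ ≤ ∑' n : ℤ, ‖1 / (2 * (Real.pi : ℂ) * I * n) ^ 2‖ := by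
    intro x
    refine (norm_tsum_le_tsum_norm ?_).trans_eq ?_
    · simpa only [norm_fourierBernoulliTwo_term] using summable_one_div_two_pi_I_mul_sq
    · simp only [norm_fourierBernoulliTwo_term]
  have hiψ : IntegrableOn (fun x => fourierBernoulliTwo x * f'' x) (Ioi 0) :=
    hi''.bdd_mul continuous_fourierBernoulliTwo.aestronglyMeasurable (.of_forall hbd)
  have hcont : ContinuousOn (fun x => fourierBernoulliTwo x * f'' x + f x) (Ici 0) :=
    (continuous_fourierBernoulliTwo.continuousOn.mul hc).add hcf
  have hii : ∀ k : ℕ, IntervalIntegrable (fun x => fourierBernoulliTwo x * f'' x + f x) volume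
      (k : ℝ) ((k + 1 : ℕ) : ℝ) := by
    intro k
    refine (hcont.mono fun x hx => ?_).intervalIntegrable
    rw [uIcc_of_le (by simp)] at hx
    exact (Nat.cast_nonneg k).trans hx.1
  -- With `ψ = -B₂/2` one has `ψ'' = -1`, so `ψ f' - ψ' f` is an antiderivative of `ψ f'' + f`. At
  -- the endpoints `ψ = -1/12` and `ψ' = ±1/2`.
  have hstep : ∀ k : ℕ, ∫ x in (k : ℝ)..((k + 1 : ℕ) : ℝ), (fourierBernoulliTwo x * f'' x + f x) =
      -(1 / 12) * (f' ((k + 1 : ℕ) : ℝ) - f' k) + (f ((k + 1 : ℕ) : ℝ) + f k) / 2 := by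
    intro k
    have hk : ∀ x ∈ uIcc (k : ℝ) ((k + 1 : ℕ) : ℝ), HasDerivAt (fun x : ℝ =>
        -(1 / 2) * (((x : ℂ) - k) ^ 2 - (x - k) + 1 / 6) * f' x +
          1 / 2 * (2 * ((x : ℂ) - k) - 1) * f x)
        (fourierBernoulliTwo x * f'' x + f x) x := by
      intro x hx
      rw [uIcc_of_le (by simp)] at hx
      have hx0 : 0 ≤ x := (Nat.cast_nonneg k).trans hx.1
      have h0 : HasDerivAt (fun x : ℝ => (x : ℂ) - k) 1 x :=
        ((hasDerivAt_id (x : ℂ)).sub_const (k : ℂ)).comp_ofReal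
      have h1 := ((((h0.pow 2).sub h0).add_const (1 / 6 : ℂ)).const_mul (-(1 / 2) : ℂ)).mul
        (hf' x hx0)
      have h2 := (((h0.const_mul (2 : ℂ)).sub_const 1).const_mul (1 / 2 : ℂ)).mul (hf x hx0)
      refine (h1.add h2).congr_deriv ?_
      rw [fourierBernoulliTwo_eq k (by simpa using hx)]
      simp
      ring
    rw [intervalIntegral.integral_eq_sub_of_hasDerivAt hk (hii k)]
    push_cast
    ring
  have hsum : ∀ N : ℕ, ∫ x in (0 : ℝ)..(N : ℝ), (fourierBernoulliTwo x * f'' x + f x) =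
      -(1 / 12) * (f' N - f' 0) + ∑ k ∈ Finset.range N, f k + (f N - f 0) / 2 := by
    intro N
    have h := intervalIntegral.sum_integral_adjacent_intervals (a := fun k : ℕ => (k : ℝ)) (n := N)
      (fun k _ => hii k)
    rw [Nat.cast_zero] at h
    rw [← h, Finset.sum_congr rfl fun k _ => hstep k]
    clear h
    induction N with
    | zero => simp
    | succ N ih =>
      rw [Finset.sum_range_succ, ih, Finset.sum_range_succ]
      push_cast
      ring
  have hlim := intervalIntegral_tendsto_integral_Ioi 0 (hiψ.add hi) tendsto_natCast_atTop_atTop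
  have hlim' : Tendsto (fun N : ℕ => ∫ x in (0 : ℝ)..(N : ℝ), (fourierBernoulliTwo x * f'' x + f x))
      atTop (𝓝 (-(1 / 12) * (0 - f' 0) + ∑' k : ℕ, f k + (0 - f 0) / 2)) := by
    simp only [hsum]
    exact (((hs'.sub_const _).const_mul _).add hs.hasSum.tendsto_sum_nat).add
      ((hs.tendsto_atTop_zero.sub_const _).div_const _)
  have heq := tendsto_nhds_unique hlim hlim'
  simp only [Pi.add_apply] at heq
  rw [integral_add hiψ hi] at heq
  -- Fubini: the integrals of the norms are `|1/(2πin)²|` times the `L¹` norm of `f''`, hence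
  -- summable.
  have hswap : ∑' n : ℤ, 1 / (2 * (Real.pi : ℂ) * I * n) ^ 2 *
      ∫ x in Ioi (0 : ℝ), exp (2 * (Real.pi : ℂ) * I * n * x) * f'' x =
      ∫ x in Ioi (0 : ℝ), fourierBernoulliTwo x * f'' x := by
    have hF := hasSum_integral_of_summable_integral_norm (μ := volume.restrict (Ioi (0 : ℝ)))
      (F := fun (n : ℤ) (x : ℝ) => 1 / (2 * (Real.pi : ℂ) * I * n) ^ 2 *
        exp (2 * (Real.pi : ℂ) * I * n * x) * f'' x) ?_ ?_
    · simp only [tsum_mul_right] at hF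
      refine Eq.trans (tsum_congr fun n => ?_) hF.tsum_eq
      rw [← integral_const_mul]
      simp only [mul_assoc]
    · intro n
      refine hi''.bdd_mul (c := ‖1 / (2 * (Real.pi : ℂ) * I * n) ^ 2‖)
        (Continuous.aestronglyMeasurable (by fun_prop))
        (.of_forall fun x => (norm_fourierBernoulliTwo_term n x).le)
    · simp only [norm_mul _ (f'' _), norm_fourierBernoulliTwo_term, integral_const_mul]
      exact summable_one_div_two_pi_I_mul_sq.mul_right _
  rw [hswap]
  linear_combination -heq

/-! ### The summation formula applied to the kernel -/

section

variable {q a : ℝ}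

theorem qKernel_zero_eq (q a : ℝ) (σ t : ℂ) (x : ℝ) :
    qKernel q a σ t 0 x = (q : ℂ) ^ (((x : ℂ) + (a : ℂ)) * t) *
      (((1 - q ^ (x + a)) / (1 - q) : ℝ) : ℂ) ^ (-σ) := by
  simp [qKernel]

theorem exp_mul_qKernel_zero (q a : ℝ) (σ t : ℂ) (n : ℤ) (x : ℝ) :
    exp (2 * (Real.pi : ℂ) * I * n * x) * qKernel q a σ t 0 x = qKernel q a σ t n x := by
  rw [qKernel_zero_eq, qKernel]
  exact (mul_assoc _ _ _).symm

theorem qHurwitzTerm_eq_qKernel (q a : ℝ) (s t : ℂ) (n : ℕ) :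
    qHurwitzTerm q s t a n = qKernel q a s t 0 n := by
  rw [qHurwitzTerm, qKernel_zero_eq, cpow_neg, div_eq_mul_inv]
  norm_cast

theorem qNumber_pos (hq0 : 0 < q) (hq1 : q < 1) (ha0 : 0 < a) {x : ℝ} (hx : 0 ≤ x) :
    0 < (1 - q ^ (x + a)) / (1 - q) :=
  div_pos (sub_pos.2 (rpow_pos_and_lt_one hq0 hq1 (show 0 < x + a by linarith)).2) (sub_pos.2 hq1)

/-- A geometric majorant. Since `1 - q^a ≤ 1 - q^{n+a} < 1`, the exponent `-|Re σ|` covers both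
signs of `Re σ`. -/
theorem norm_qKernel_le (hq0 : 0 < q) (hq1 : q < 1) (ha0 : 0 < a) (σ t : ℂ) (n : ℕ) :
    ‖qKernel q a σ t 0 n‖ ≤ q ^ (a * t.re) * ((1 - q ^ a) ^ (-|σ.re|) / (1 - q) ^ (-σ.re)) *
      (q ^ t.re) ^ n := by
  have hu1 := (rpow_pos_and_lt_one hq0 hq1 ha0).2
  have hx : (0 : ℝ) ≤ n := Nat.cast_nonneg n
  obtain ⟨hy0, hy1⟩ := rpow_pos_and_lt_one hq0 hq1 (show 0 < (n : ℝ) + a by linarith)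
  have hle : q ^ ((n : ℝ) + a) ≤ q ^ a := Real.rpow_le_rpow_of_exponent_ge hq0 hq1.le (by linarith)
  rw [qKernel_zero_eq, norm_mul, norm_cpow_eq_rpow_re_of_pos hq0,
    norm_cpow_eq_rpow_re_of_pos (qNumber_pos hq0 hq1 ha0 hx),
    Real.div_rpow (by linarith) (by linarith)]
  have e : ((((n : ℝ) : ℂ) + (a : ℂ)) * t).re = a * t.re + t.re * n := by
    simp
    ring
  rw [e, Real.rpow_add hq0, Real.rpow_mul hq0.le t.re, Real.rpow_natCast, mul_right_comm, neg_re]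
  have h1 : (0 : ℝ) < 1 - q := sub_pos.2 hq1
  gcongr
  calc (1 - q ^ ((n : ℝ) + a)) ^ (-σ.re) ≤ (1 - q ^ ((n : ℝ) + a)) ^ (-|σ.re|) :=
        Real.rpow_le_rpow_of_exponent_ge (sub_pos.2 hy1) (by linarith)
          (by linarith [le_abs_self σ.re])
    _ ≤ _ := Real.rpow_le_rpow_of_nonpos (sub_pos.2 hu1) (by linarith)
          (neg_nonpos.2 (abs_nonneg _))

theorem summable_norm_qKernel (hq0 : 0 < q) (hq1 : q < 1) (ha0 : 0 < a) (σ : ℂ) {t : ℂ}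
    (ht : 0 < t.re) : Summable fun n : ℕ => ‖qKernel q a σ t 0 n‖ := by
  refine Summable.of_nonneg_of_le (fun _ => norm_nonneg _) (norm_qKernel_le hq0 hq1 ha0 σ t)
    (Summable.mul_left _ ?_)
  obtain ⟨h0, h1⟩ := rpow_pos_and_lt_one hq0 hq1 ht
  exact summable_geometric_of_lt_one h0.le h1

/-- Replacing `q^{x+a}` by `1 - (1-q)[x+a]_q` in the derivative of `[x+a]_q^{-σ}` keeps the result
in the span of the kernels with `σ` and `σ+1`. -/
theorem hasDerivAt_qKernel (hq0 : 0 < q) (hq1 : q < 1) (ha0 : 0 < a) (σ t : ℂ) {x : ℝ}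
    (hx : 0 ≤ x) : HasDerivAt (qKernel q a σ t 0) (Real.log q * (t - σ) * qKernel q a σ t 0 x +
      σ * Real.log q / (1 - q) * qKernel q a (σ + 1) t 0 x) x := by
  have hw := qNumber_pos hq0 hq1 ha0 hx
  have h1q : ((1 : ℂ) - q) ≠ 0 := by
    have := ofReal_ne_zero.2 (sub_pos.2 hq1).ne'
    push_cast at this
    exact this
  have h1 : HasDerivAt (fun x : ℝ => (q : ℂ) ^ (((x : ℂ) + (a : ℂ)) * t))
      ((q : ℂ) ^ (((x : ℂ) + (a : ℂ)) * t) * (Real.log q * t)) x := by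
    have := ((((hasDerivAt_id (x : ℂ)).add_const (a : ℂ)).mul_const t).const_cpow
      (c := (q : ℂ)) (Or.inl (ofReal_ne_zero.2 hq0.ne'))).comp_ofReal
    refine this.congr_deriv ?_
    rw [ofReal_log hq0.le]
    simp
    ring
  have h2 : HasDerivAt (fun x : ℝ => (((1 - q ^ (x + a)) / (1 - q) : ℝ) : ℂ) ^ (-σ))
      (-σ * (((1 - q ^ (x + a)) / (1 - q) : ℝ) : ℂ) ^ (-σ - 1) *
        ((-(q ^ (x + a) * Real.log q) / (1 - q) : ℝ) : ℂ)) x := by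
    have h3 := (((hasDerivAt_rpow_add (a := a) hq0 x).const_sub 1).div_const (1 - q)).ofReal_comp
    have h4 := ((hasDerivAt_id ((((1 - q ^ (x + a)) / (1 - q) : ℝ) : ℂ))).cpow_const (c := -σ)
      (ofReal_mem_slitPlane.2 hw))
    have h5 := h4.scomp x h3
    refine h5.congr_deriv ?_
    simp
    ring
  have h := h1.mul h2
  have hfun : qKernel q a σ t 0 = fun x : ℝ => (q : ℂ) ^ (((x : ℂ) + (a : ℂ)) * t) *
      (((1 - q ^ (x + a)) / (1 - q) : ℝ) : ℂ) ^ (-σ) := funext (qKernel_zero_eq q a σ t)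
  rw [hfun]
  refine h.congr_deriv ?_
  rw [qKernel_zero_eq, show -(σ + 1) = -σ - 1 by ring]
  have hsub : (((1 - q ^ (x + a)) / (1 - q) : ℝ) : ℂ) ^ (-σ) =
      (((1 - q ^ (x + a)) / (1 - q) : ℝ) : ℂ) ^ (-σ - 1) *
        (((1 - q ^ (x + a)) / (1 - q) : ℝ) : ℂ) := by
    have := cpow_add (-σ - 1) 1 (ofReal_ne_zero.2 hw.ne')
    rwa [sub_add_cancel, cpow_one] at this
  simp only [hsub]
  generalize (((1 - q ^ (x + a)) / (1 - q) : ℝ) : ℂ) ^ (-σ - 1) = W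
  push_cast
  field_simp
  ring

theorem continuousOn_qKernel (hq0 : 0 < q) (hq1 : q < 1) (ha0 : 0 < a) (σ t : ℂ) :
    ContinuousOn (qKernel q a σ t 0) (Ici 0) := fun _ hx =>
  (hasDerivAt_qKernel hq0 hq1 ha0 σ t hx).continuousAt.continuousWithinAt

theorem qHurwitz_eq (hq0 : 0 < q) (hq1 : q < 1) (ha0 : 0 < a) (s : ℂ) {t : ℂ} (ht : 0 < t.re) :
    qHurwitz q s t a = qBoundary q a s t -
      ((1 - q : ℝ) : ℂ) ^ s / (Real.log q : ℂ) * incBeta (q ^ a) t (-s + 1) +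
      ∑ ε : Fin 3, 2 * ((1 - q : ℝ) : ℂ) ^ s / (Real.log q : ℂ) * qCoeff q s t ε *
        ∑' n : ℤ, qFourierWeight a n *
          incBeta (q ^ a) (t + qDelta q * n) (1 - s - ((ε : ℕ) : ℂ)) := by
  obtain ⟨hu0, hu1⟩ := rpow_pos_and_lt_one hq0 hq1 ha0
  have hL0 : (Real.log q : ℂ) ≠ 0 := ofReal_ne_zero.2 (Real.log_neg hq0 hq1).ne
  have hv0 : ((1 - q : ℝ) : ℂ) ≠ 0 := ofReal_ne_zero.2 (sub_pos.2 hq1).ne'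
  have hw0 : ((1 - q ^ a : ℝ) : ℂ) ≠ 0 := ofReal_ne_zero.2 (sub_pos.2 hu1).ne'
  set L : ℂ := (Real.log q : ℂ) with hL
  set v : ℂ := ((1 - q : ℝ) : ℂ) with hv
  have hv' : (1 : ℂ) - q = v := by
    rw [hv]
    push_cast
    rfl
  set h : ℂ → ℝ → ℂ := fun σ => qKernel q a σ t 0 with hh
  have hd : ∀ (σ : ℂ) (x : ℝ), 0 ≤ x →
      HasDerivAt (h σ) (L * (t - σ) * h σ x + σ * L / v * h (σ + 1) x) x := by
    intro σ x hx
    rw [← hv']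
    exact hasDerivAt_qKernel hq0 hq1 ha0 σ t hx
  have hint : ∀ σ, IntegrableOn (h σ) (Ioi 0) := fun σ => integrableOn_qKernel hq0 hq1 ha0 σ ht 0
  have hcont : ∀ σ, ContinuousOn (h σ) (Ici 0) := fun σ => continuousOn_qKernel hq0 hq1 ha0 σ t
  have hsum : ∀ σ, Summable fun n : ℕ => h σ n := fun σ =>
    (summable_norm_qKernel hq0 hq1 ha0 σ ht).of_norm
  have hbeta : ∀ ε : Fin 3, Summable fun n : ℤ => 2 * v ^ s / L * qCoeff q s t ε *
      (qFourierWeight a n * incBeta (q ^ a) (t + qDelta q * n) (1 - s - ((ε : ℕ) : ℂ))) := by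
    intro ε
    refine Summable.mul_left _ (Summable.of_norm ?_)
    -- With `M = 1` there is no integration by parts and no denominator, so the general bound covers
    -- the plain beta function.
    have := summable_norm_mul_incBetaCont (M := 1) hq0 hq1 hu0 hu1 (summable_qFourierWeight a)
      (t := t) (by simpa using ht) (fun n _ j hj => absurd hj (by simp)) (1 - s - ((ε : ℕ) : ℂ))
    refine this.congr fun n => ?_
    rw [incBetaCont_eq_incBeta hu0 hu1 le_rfl]
    simpa [qDelta_re] using ht
  have key := tsum_eq_integral_add_tsum_fourier (f := h s)
    (f' := fun x => L * (t - s) * h s x + s * L / v * h (s + 1) x)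
    (f'' := fun x => L * (t - s) * (L * (t - s) * h s x + s * L / v * h (s + 1) x) +
      s * L / v * (L * (t - (s + 1)) * h (s + 1) x + (s + 1) * L / v * h (s + 2) x))
    (hd s) (fun x hx => ?_) ?_ (hint s) ?_ (hsum s) ?_
  · have hs' : qHurwitz q s t a = ∑' n : ℕ, h s n :=
      tsum_congr fun n => qHurwitzTerm_eq_qKernel q a s t n
    rw [hs', key]
    have hI : ∫ x in Ioi (0 : ℝ), h s x = -(v ^ s / L * incBeta (q ^ a) t (-s + 1)) := by
      have := integral_qKernel hq0 hq1 ha0 s t 0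
      simp only [hh]
      rw [this]
      simp [add_comm, sub_eq_add_neg, hv, hL, neg_mul]
    have hB : h s 0 / 2 - (L * (t - s) * h s 0 + s * L / v * h (s + 1) 0) / 12 =
        qBoundary q a s t := by
      simp only [hh, qKernel_zero_eq, zero_add, ofReal_zero, qBoundary, neg_add]
      have hc0 : (((1 - q ^ a) / (1 - q) : ℝ) : ℂ) ≠ 0 := by
        rw [ofReal_div]
        exact div_ne_zero hw0 hv0
      rw [cpow_add _ _ hc0, cpow_neg_one]
      generalize (((1 - q ^ a) / (1 - q) : ℝ) : ℂ) ^ (-s) = W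
      rw [ofReal_div, ofReal_div]
      field_simp
      ring
    rw [← hB, hI]
    -- Each kernel integral contributes `-(1-q)^{s+ε} / log q`; the powers of `1-q` cancel those in
    -- `f''`, leaving `2 a_ε`.
    have hR : ∀ n : ℤ, 1 / (2 * (Real.pi : ℂ) * I * n) ^ 2 *
        ∫ x in Ioi (0 : ℝ), exp (2 * (Real.pi : ℂ) * I * n * x) *
          (L * (t - s) * (L * (t - s) * h s x + s * L / v * h (s + 1) x) +
          s * L / v * (L * (t - (s + 1)) * h (s + 1) x + (s + 1) * L / v * h (s + 2) x)) =
        ∑ ε : Fin 3, 2 * v ^ s / L * qCoeff q s t ε * (qFourierWeight a n *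
          incBeta (q ^ a) (t + qDelta q * n) (1 - s - ((ε : ℕ) : ℂ))) := by
      intro n
      have hi : ∀ σ, IntegrableOn (qKernel q a σ t n) (Ioi 0) := fun σ =>
        integrableOn_qKernel hq0 hq1 ha0 σ ht n
      have e : ∫ x in Ioi (0 : ℝ), exp (2 * (Real.pi : ℂ) * I * n * x) *
          (L * (t - s) * (L * (t - s) * h s x + s * L / v * h (s + 1) x) +
          s * L / v * (L * (t - (s + 1)) * h (s + 1) x + (s + 1) * L / v * h (s + 2) x)) =
          ∫ x in Ioi (0 : ℝ), ((L * (t - s)) ^ 2 * qKernel q a s t n x +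
            L ^ 2 * s / v * (2 * (t - s) - 1) * qKernel q a (s + 1) t n x +
            L ^ 2 * s * (s + 1) / v ^ 2 * qKernel q a (s + 2) t n x) := by
        refine integral_congr_ae (.of_forall fun x => ?_)
        simp only [hh, ← exp_mul_qKernel_zero q a _ t n x]
        field_simp
        ring
      have hi0 := (hi s).const_mul ((L * (t - s)) ^ 2)
      have hi1 := (hi (s + 1)).const_mul (L ^ 2 * s / v * (2 * (t - s) - 1))
      have hi2 := (hi (s + 2)).const_mul (L ^ 2 * s * (s + 1) / v ^ 2)
      have hi01 : Integrable (fun x => (L * (t - s)) ^ 2 * qKernel q a s t n x +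
          L ^ 2 * s / v * (2 * (t - s) - 1) * qKernel q a (s + 1) t n x)
          (volume.restrict (Ioi (0 : ℝ))) := hi0.add hi1
      rw [e, integral_add hi01 hi2, integral_add hi0 hi1, integral_const_mul,
        integral_const_mul, integral_const_mul, integral_qKernel hq0 hq1 ha0,
        integral_qKernel hq0 hq1 ha0, integral_qKernel hq0 hq1 ha0, Fin.sum_univ_three]
      simp only [qCoeff, qFourierWeight, ← hv, ← hL]
      rw [cpow_add _ _ hv0, cpow_add _ _ hv0, cpow_one, cpow_ofNat,
        show 1 - (s + 1) = 1 - s - 1 by ring, show 1 - (s + 2) = 1 - s - 2 by ring,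
        show ((((0 : Fin 3) : ℕ)) : ℂ) = 0 by simp, show ((((1 : Fin 3) : ℕ)) : ℂ) = 1 by simp,
        show ((((2 : Fin 3) : ℕ)) : ℂ) = 2 by simp, sub_zero]
      field_simp
      ring
    rw [tsum_congr hR, Summable.tsum_finsetSum fun ε _ => hbeta ε]
    simp only [tsum_mul_left]
    ring
  · have e := hd (s + 1) x hx
    rw [show s + 1 + 1 = s + 2 by ring] at e
    exact ((hd s x hx).const_mul _).add (e.const_mul _)
  · have h0 := hcont s
    have h1 := hcont (s + 1)
    have h2 := hcont (s + 2)
    fun_prop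
  · exact ((((hint s).const_mul _).add ((hint _).const_mul _)).const_mul _).add
      ((((hint _).const_mul _).add ((hint _).const_mul _)).const_mul _)
  · have h1 := ((hsum s).tendsto_atTop_zero.const_mul (L * (t - s))).add
      ((hsum (s + 1)).tendsto_atTop_zero.const_mul (s * L / v))
    simpa using h1

end

/-! ### Assembling the continuation -/

section

variable {q a : ℝ} {M : ℕ}

/-- The isolated beta term is the series with one coefficient, so the results on holomorphy and
poles treat it together with the Fourier series. -/
theorem incBetaContSum_single (q : ℝ) (M : ℕ) (x : ℝ) (t β : ℂ) :
    incBetaContSum q M x (Pi.single 0 1) (t, β) = incBetaCont M x t β := by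
  rw [incBetaContSum, tsum_eq_single 0]
  · simp
  · intro n hn
    simp [Pi.single_eq_of_ne hn]

theorem summable_norm_single_int : Summable fun n : ℤ => ‖(Pi.single 0 1 : ℤ → ℂ) n‖ := by
  refine summable_of_ne_finset_zero (s := {0}) fun n hn => ?_
  rw [Finset.mem_singleton] at hn
  simp [Pi.single_eq_of_ne hn]

/-- The continuation of the `q`-Hurwitz zeta function, expressed through series of continued
incomplete beta functions. -/
theorem qHurwitzCont_eq (hq0 : 0 < q) (hq1 : q < 1) (ha0 : 0 < a) (hM : 1 ≤ M) (s t : ℂ) :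
    qHurwitzCont q a M s t = qBoundary q a s t -
      ((1 - q : ℝ) : ℂ) ^ s / (Real.log q : ℂ) *
        incBetaContSum q M (q ^ a) (Pi.single 0 1) (t, -s + 1) +
      ∑ ε : Fin 3, 2 * ((1 - q : ℝ) : ℂ) ^ s / (Real.log q : ℂ) * qCoeff q s t ε *
        incBetaContSum q M (q ^ a) (qFourierWeight a) (t, 1 - s - ((ε : ℕ) : ℂ)) := by
  simp only [qHurwitzCont, qFourierCTilde_eq hq0 hq1 ha0 hM, incBetaContSum_single]

theorem qHurwitzCont_eq_qHurwitz (hq0 : 0 < q) (hq1 : q < 1) (ha0 : 0 < a) (hM : 1 ≤ M) (s : ℂ)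
    {t : ℂ} (ht : 0 < t.re) : qHurwitzCont q a M s t = qHurwitz q s t a := by
  obtain ⟨hu0, hu1⟩ := rpow_pos_and_lt_one hq0 hq1 ha0
  rw [qHurwitzCont_eq hq0 hq1 ha0 hM, qHurwitz_eq hq0 hq1 ha0 s ht, incBetaContSum_single,
    incBetaCont_eq_incBeta hu0 hu1 hM ht]
  congr 1
  refine Finset.sum_congr rfl fun ε _ => congrArg _ (tsum_congr fun n => ?_)
  rw [incBetaCont_eq_incBeta hu0 hu1 hM]
  rwa [add_re, qDelta_mul_intCast_re, add_zero]

theorem differentiable_qBoundary (hq0 : 0 < q) (hq1 : q < 1) (ha0 : 0 < a) :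
    Differentiable ℂ fun p : ℂ × ℂ => qBoundary q a p.1 p.2 := by
  have hc0 : (((1 - q ^ a) / (1 - q) : ℝ) : ℂ) ≠ 0 := by
    have := qNumber_pos hq0 hq1 ha0 le_rfl
    rw [zero_add] at this
    exact ofReal_ne_zero.2 this.ne'
  have h1 : Differentiable ℂ fun p : ℂ × ℂ => (q : ℂ) ^ ((a : ℂ) * p.2) := fun p =>
    DifferentiableAt.const_cpow (by fun_prop) (Or.inl (ofReal_ne_zero.2 hq0.ne'))
  have h2 : Differentiable ℂ fun p : ℂ × ℂ => (((1 - q ^ a) / (1 - q) : ℝ) : ℂ) ^ (-p.1) :=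
    fun p => DifferentiableAt.const_cpow (by fun_prop) (Or.inl hc0)
  unfold qBoundary
  exact ((h1.const_mul _).mul h2).sub (((h1.const_mul _).mul h2).mul (by fun_prop))

theorem differentiable_one_sub_cpow (hq1 : q < 1) :
    Differentiable ℂ fun p : ℂ × ℂ => ((1 - q : ℝ) : ℂ) ^ p.1 := fun _ =>
  DifferentiableAt.const_cpow (by fun_prop) (Or.inl (ofReal_ne_zero.2 (sub_pos.2 hq1).ne'))

theorem differentiable_qCoeff (q : ℝ) (ε : Fin 3) :
    Differentiable ℂ fun p : ℂ × ℂ => qCoeff q p.1 p.2 ε := by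
  fin_cases ε <;> simp only [qCoeff] <;> fun_prop

/-- Holomorphy of a combination of boundary terms and incomplete beta series. -/
theorem differentiableAt_combination (hq1 : q < 1) {B G₁ G₂ : ℂ × ℂ → ℂ} {p : ℂ × ℂ}
    (hB : DifferentiableAt ℂ B p) (hG₁ : ∀ β, DifferentiableAt ℂ G₁ (p.2, β))
    (hG₂ : ∀ β, DifferentiableAt ℂ G₂ (p.2, β)) :
    DifferentiableAt ℂ (fun p : ℂ × ℂ => B p -
      ((1 - q : ℝ) : ℂ) ^ p.1 / (Real.log q : ℂ) * G₁ (p.2, -p.1 + 1) +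
      ∑ ε : Fin 3, 2 * ((1 - q : ℝ) : ℂ) ^ p.1 / (Real.log q : ℂ) * qCoeff q p.1 p.2 ε *
        G₂ (p.2, 1 - p.1 - ((ε : ℕ) : ℂ))) p := by
  have hv := (differentiable_one_sub_cpow hq1).differentiableAt (x := p)
  have h1 : DifferentiableAt ℂ (fun p : ℂ × ℂ => G₁ (p.2, -p.1 + 1)) p :=
    DifferentiableAt.comp (f := fun p : ℂ × ℂ => (p.2, -p.1 + 1)) p (hG₁ _) (by fun_prop)
  have h2 : ∀ ε : Fin 3,
      DifferentiableAt ℂ (fun p : ℂ × ℂ => G₂ (p.2, 1 - p.1 - ((ε : ℕ) : ℂ))) p := fun ε =>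
    DifferentiableAt.comp (f := fun p : ℂ × ℂ => (p.2, 1 - p.1 - ((ε : ℕ) : ℂ))) p (hG₂ _)
      (by fun_prop)
  simp only [div_eq_mul_inv]
  refine (hB.sub ((hv.mul_const _).mul h1)).add (DifferentiableAt.fun_sum fun ε _ => ?_)
  exact (((hv.const_mul _).mul_const _).mul (differentiable_qCoeff q ε).differentiableAt).mul (h2 ε)

theorem differentiableAt_qHurwitzCont (hq0 : 0 < q) (hq1 : q < 1) (ha0 : 0 < a) (hM : 1 ≤ M)
    {p : ℂ × ℂ} (hp : 1 - (M : ℝ) < p.2.re) (hp' : p.2 ∉ qPoles q M) :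
    DifferentiableAt ℂ (fun p : ℂ × ℂ => qHurwitzCont q a M p.1 p.2) p := by
  obtain ⟨hu0, hu1⟩ := rpow_pos_and_lt_one hq0 hq1 ha0
  simp only [qHurwitzCont_eq hq0 hq1 ha0 hM]
  exact differentiableAt_combination hq1 (differentiable_qBoundary hq0 hq1 ha0).differentiableAt
    (fun β => differentiableAt_incBetaContSum hq0 hq1 hu0 hu1 summable_norm_single_int hp
      fun n _ _ hj => add_qDelta_ne_zero_of_notMem_qPoles hp' n hj)
    (fun β => differentiableAt_incBetaContSum hq0 hq1 hu0 hu1 (summable_qFourierWeight a) hp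
      fun n _ _ hj => add_qDelta_ne_zero_of_notMem_qPoles hp' n hj)

/-- Multiply the decomposition by `t - t₀`; both beta series become holomorphic on the same `U`,
which does not depend on the coefficients. -/
theorem exists_qHurwitzCont_eq_div (hq0 : 0 < q) (hq1 : q < 1) (ha0 : 0 < a) (hM : 1 ≤ M) {t₀ : ℂ}
    (ht₀ : t₀ ∈ qPoles q M) : ∃ (U : Set ℂ) (H : ℂ × ℂ → ℂ), IsOpen U ∧ t₀ ∈ U ∧
      (∀ p : ℂ × ℂ, p.2 ∈ U → DifferentiableAt ℂ H p) ∧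
      ∀ s t : ℂ, t ∈ U → t ≠ t₀ → qHurwitzCont q a M s t = H (s, t) / (t - t₀) := by
  obtain ⟨hu0, hu1⟩ := rpow_pos_and_lt_one hq0 hq1 ha0
  obtain ⟨U, hU, htU, hUG⟩ :=
    exists_isOpen_incBetaContSum_eq_div (x := q ^ a) hq0 hq1 hu0 hu1 ht₀
  obtain ⟨G₁, hG₁, hG₁'⟩ := hUG _ summable_norm_single_int
  obtain ⟨G₂, hG₂, hG₂'⟩ := hUG _ (summable_qFourierWeight a)
  refine ⟨U, fun p => (p.2 - t₀) * qBoundary q a p.1 p.2 -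
      ((1 - q : ℝ) : ℂ) ^ p.1 / (Real.log q : ℂ) * G₁ (p.2, -p.1 + 1) +
      ∑ ε : Fin 3, 2 * ((1 - q : ℝ) : ℂ) ^ p.1 / (Real.log q : ℂ) * qCoeff q p.1 p.2 ε *
        G₂ (p.2, 1 - p.1 - ((ε : ℕ) : ℂ)), hU, htU, fun p hp => ?_, fun s t ht htne => ?_⟩
  · refine differentiableAt_combination hq1 (DifferentiableAt.mul (by fun_prop)
      (differentiable_qBoundary hq0 hq1 ha0).differentiableAt)
      (fun β => hG₁ _ hp) (fun β => hG₂ _ hp)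
  · rw [eq_div_iff (sub_ne_zero.2 htne), qHurwitzCont_eq hq0 hq1 ha0 hM]
    simp only [← hG₁' t ht htne, ← hG₂' t ht htne, Fin.sum_univ_three]
    ring

end

theorem mainTheorem8 (q a : ℝ) (hq0 : 0 < q) (hq1 : q < 1) (ha0 : 0 < a) (ha1 : a ≤ 1)
    (M : ℕ) (hM : 2 ≤ M) :
    -- the formula in the region `Re t > 0` of absolute convergence
    (∀ s t : ℂ, -(M : ℝ) < s.re → 0 < t.re →
      Summable (fun n : ℕ => ‖qHurwitzTerm q s t a n‖) ∧
      qHurwitz q s t a =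
        (1 / 2) * (q : ℂ) ^ ((a : ℂ) * t) * (((1 - q ^ a) / (1 - q) : ℝ) : ℂ) ^ (-s) -
        (1 / 12) * (q : ℂ) ^ ((a : ℂ) * t) * (((1 - q ^ a) / (1 - q) : ℝ) : ℂ) ^ (-s) *
          ((((1 - q ^ a) / Real.log q : ℝ) : ℂ)⁻¹ * s + (t - s) * (Real.log q : ℂ)) -
        ((1 - q : ℝ) : ℂ) ^ s / (Real.log q : ℂ) * incBeta (q ^ a) t (-s + 1) +
        ∑ ε : Fin 3, qFourierCTilde q a M s t ε) ∧
    -- the incomplete beta integral converges absolutely for `Re α > 0`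
    (∀ α β : ℂ, 0 < α.re →
      IntervalIntegrable (incBetaIntegrand α β) MeasureTheory.volume 0 (q ^ a)) ∧
    -- its analytic continuation to `Re α > 1 - M`
    (∀ α β : ℂ, 0 < α.re → incBetaCont M (q ^ a) α β = incBeta (q ^ a) α β) ∧
    DifferentiableOn ℂ (fun p : ℂ × ℂ => incBetaCont M (q ^ a) p.1 p.2)
      {p : ℂ × ℂ | 1 - (M : ℝ) < p.1.re ∧ ∀ j : ℕ, j + 2 ≤ M → p.1 ≠ -(j : ℂ)} ∧
    -- the integrals and series in `C̃_ε` converge absolutely for `Re t > 1 - M` off the poles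
    (∀ s t : ℂ, -(M : ℝ) < s.re → 1 - (M : ℝ) < t.re → t ∉ qPoles q M → ∀ ε : Fin 3,
      (∀ n : ℤ, n ≠ 0 →
        MeasureTheory.IntegrableOn (qFourierIntegrand q a M s t ε n) (Set.Ioi (0 : ℝ))) ∧
      Summable (fun n : {n : ℤ // n ≠ 0} => ‖qFourierTerm q a M s t ε n‖)) ∧
    -- the right-hand side is the analytic continuation of `g_q(s,t,a)`:
    -- it agrees with the series for `Re t > 0`,
    (∀ s t : ℂ, -(M : ℝ) < s.re → 0 < t.re → qHurwitzCont q a M s t = qHurwitz q s t a) ∧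
    -- is holomorphic in `(s,t)` for `Re t > 1 - M` off the poles,
    DifferentiableOn ℂ (fun p : ℂ × ℂ => qHurwitzCont q a M p.1 p.2)
      {p : ℂ × ℂ | -(M : ℝ) < p.1.re ∧ 1 - (M : ℝ) < p.2.re ∧ p.2 ∉ qPoles q M} ∧
    -- and has at most simple poles along `t = t₀`, for `t₀` in the polar set
    (∀ t₀ ∈ qPoles q M, ∃ (U : Set ℂ) (H : ℂ × ℂ → ℂ), IsOpen U ∧ t₀ ∈ U ∧
      DifferentiableOn ℂ H {p : ℂ × ℂ | -(M : ℝ) < p.1.re ∧ p.2 ∈ U} ∧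
      ∀ s t : ℂ, -(M : ℝ) < s.re → t ∈ U → t ≠ t₀ →
        qHurwitzCont q a M s t = H (s, t) / (t - t₀)) := by
  obtain ⟨hu0, hu1⟩ := rpow_pos_and_lt_one hq0 hq1 ha0
  have hM1 : 1 ≤ M := by omega
  refine ⟨fun s t _ ht => ⟨?_, ?_⟩,
    fun α β hα => intervalIntegrable_incBetaIntegrand hu0 hu1 hα β,
    fun α β hα => incBetaCont_eq_incBeta hu0 hu1 hM1 hα β, ?_, ?_,
    fun s t _ ht => qHurwitzCont_eq_qHurwitz hq0 hq1 ha0 hM1 s ht,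
    fun p hp => (differentiableAt_qHurwitzCont hq0 hq1 ha0 hM1 hp.2.1
      hp.2.2).differentiableWithinAt, ?_⟩
  · simpa only [qHurwitzTerm_eq_qKernel] using summable_norm_qKernel hq0 hq1 ha0 s ht
  · rw [← qHurwitzCont_eq_qHurwitz hq0 hq1 ha0 hM1 s ht, qHurwitzCont, qBoundary,
      incBetaCont_eq_incBeta hu0 hu1 hM1 ht]
  · intro p hp
    refine (differentiableAt_incBetaCont hu0 hu1 hp.1 fun j hj h0 => ?_).differentiableWithinAt
    exact hp.2 j (by omega) (eq_neg_of_add_eq_zero_left h0)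
  · intro s t _ ht htP ε
    refine ⟨fun n _ => ?_, ?_⟩
    · rw [qFourierIntegrand_eq_qKernel]
      refine integrableOn_qKernel hq0 hq1 ha0 _ ?_ n
      simp only [sub_re, add_re, natCast_re, one_re]
      linarith
    · simp only [qFourierTerm_eq hq0 hq1 ha0 hM1, norm_mul (_ / _)]
      exact ((summable_norm_mul_incBetaCont hq0 hq1 hu0 hu1 (summable_qFourierWeight a) ht
        (fun n _ _ hj => add_qDelta_ne_zero_of_notMem_qPoles htP n hj) _).mul_left _).subtype
        {n : ℤ | n ≠ 0}
  · intro t₀ ht₀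
    obtain ⟨U, H, hU, htU, hH, hH'⟩ := exists_qHurwitzCont_eq_div (a := a) hq0 hq1 ha0 hM1 ht₀
    exact ⟨U, H, hU, htU, fun p hp => (hH p hp.2).differentiableWithinAt,
      fun s t _ ht htne => hH' s t ht htne⟩
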